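/- Consider the linear impulsive system with delays $$\begin{aligned} \dot x(t_k+\tau)&=A(\tau)x(t_k+\tau)+G_c(\tau)x(t_k+\tau-h_c)+E_c(\tau)w_c(t_k+\tau),\\ z_c(t_k+\tau)&=C_cx(t_k+\tau)+H_cx(t_k+\tau-h_c)+F_cw_c(t_k+\tau),\qquad \tau\in(0,T_k],\ k\ge 0,\\ x(t_k^+)&=Jx(t_k)+G_dx(t_{k-h_d})+E_dw_d(k),\\ z_d(k)&=C_dx(t_k)+H_dx(t_{k-h_d})+F_dw_d(k),\qquad k\ge 1,\\ x(s)&=\phi_0(s),\ s\in[-h_c,0],\qquad x(t_{-j})=\psi_j,\ 1\le j<h_d, \end{aligned}$$ where $t_0=0$ (no jump there), $t_{k+1}=t_k+T_k$, $T_k>0$, $t_k\to\infty$, $x(t)\in\mathbb R^n$, $\phi_0$ is continuous, $A,G_c,E_c$ are continuous functions of $\tau\ge0$ and all other matrices are constant. Solutions are left-continuous at impulse times and, on each $(t_k,t_{k+1}]$, are absolutely continuous and satisfy the differential equation almost everywhere. Vectors are measured in the $1$-norm, which also defines $\|\cdot\|_{L_1}$ and $\|\cdot\|_{\ell_1}$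 (discrete signals being indexed by $k\ge1$), and $\|(\phi_0,\psi)\|:=\sup_{s\in[-h_c,0]}\|\phi_0(s)\|+\sum_{1\le j<h_d}\|\psi_j\|$. Vector inequalities are componentwise, and $\mathbb 1$ is the vector of ones. Let $\bar T>0$ and suppose that $A(\tau),G_c(\tau),E_c(\tau)$ are constant for $\tau\ge\bar T$. Assume that the system is internally positive: for all delays $h_c>0$, $h_d\in\mathbb Z_{\ge0}$ and all impulse times as above, nonnegative initial data and nonnegative inputs $w_c,w_d$ yield $x(t)\ge0$ for $t\ge0$, $z_c(t)\ge0$ for $t>0$ and $z_d(k)\ge0$ for $k\ge1$. Assume further that there exist a differentiable function $\zeta:[0,\bar T]\to\mathbb R^n$ with $\zeta(0)>0$ and scalars $\epsilon,\gamma>0$ such that $$\begin{bmatrix}\zeta(\bar T)\\ \mathbb 1\end{bmatrix}^T\begin{bmatrix}A(\bar T)+G_c(\bar T)&E_c(\bar T)\\ C_c+H_c&F_c\end{bmatrix}\le\begin{bmatrix}-\epsilon\mathbb 1\\ \gamma\mathbb 1\end{bmatrix}^T,$$ $$\begin{bmatrix}\dot\zeta(\tau)\\0\end{bmatrix}^T+\begin{bmatrix}\zeta(\tau)\\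 \mathbb 1\end{bmatrix}^T\begin{bmatrix}A(\tau)+G_c(\tau)&E_c(\tau)\\ C_c+H_c&F_c\end{bmatrix}\le\begin{bmatrix}0\\ \gamma\mathbb 1\end{bmatrix}^T\quad\text{for all }\tau\in[0,\bar T],$$ $$\begin{bmatrix}-\zeta(\bar T)\\0\end{bmatrix}^T+\begin{bmatrix}\zeta(0)\\ \mathbb 1\end{bmatrix}^T\begin{bmatrix}J+G_d&E_d\\ C_d+H_d&F_d\end{bmatrix}\le\begin{bmatrix}-\epsilon\mathbb 1\\ \gamma\mathbb 1\end{bmatrix}^T.$$ For $h_c>0$ let $\mathcal T_{MDT,p}(h_c)$ be the set of sequences $(T_k)_{k\ge0}$ for which there are integers $q,\alpha\ge1$ and numbers $\beta_0,\dots,\beta_{q-1}\ge\bar T$ with $T_{qi+k}=\beta_k$ for all $i\ge0$, $0\le k<q$, and $\sum_{i=0}^{q-1}T_i=h_c/\alpha$. Then, for all delays $h_c>0$ and $h_d\in\mathbb Z_{\ge0}$ and all dwell-time sequences in $\mathcal T_{MDT,p}(h_c)$: 1. the system with $w_c\equiv0$, $w_d\equiv0$ is (globally) asymptotically stable, i.e.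 for every $\eta>0$ there is $\delta>0$ such that $\|(\phi_0,\psi)\|<\delta$ implies $\|x(t)\|<\eta$ for all $t\ge0$, and every solution tends to $0$ as $t\to\infty$; 2. the map $(w_c,w_d)\mapsto(z_c,z_d)$ has a hybrid $L_1/\ell_1$-gain of at most $\gamma$, i.e. there is an increasing function $v$ on $[0,\infty)$ with $v(0)=0$ and $v(s)\to\infty$ as $s\to\infty$ such that, for all initial data and all $w_c\in L_1$, $w_d\in\ell_1$, one has $z_c\in L_1$, $z_d\in\ell_1$ and $$\|z_c\|_{L_1}+\|z_d\|_{\ell_1}\le\gamma\left(\|w_c\|_{L_1}+\|w_d\|_{\ell_1}\right)+v(\|(\phi_0,\psi)\|).$$ -/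

import Mathlib

open MeasureTheory Filter Topology Matrix

/-- The data of a linear impulsive system with one continuous-time and one discrete-time delay,
with timer-dependent (continuous) matrices `A`, `Gc`, `Ec` and constant matrices otherwise:

* flow: `x'(t_k+τ) = A(τ) x(t_k+τ) + Gc(τ) x(t_k+τ-h_c) + Ec(τ) w_c(t_k+τ)`, `τ ∈ (0,T_k]`,
  with output `z_c(t) = Cc x(t) + Hc x(t-h_c) + Fc w_c(t)`;
* jump: `x(t_k⁺) = J x(t_k) + Gd x(t_{k-h_d}) + Ed w_d(k)`, `k ≥ 1`,
  with output `z_d(k) = Cd x(t_k) + Hd x(t_{k-h_d}) + Fd w_d(k)`. -/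
structure ImpulsiveDelaySystem (n pc pd qc qd : ℕ) where
  A : ℝ → Matrix (Fin n) (Fin n) ℝ
  Gc : ℝ → Matrix (Fin n) (Fin n) ℝ
  Ec : ℝ → Matrix (Fin n) (Fin pc) ℝ
  Cc : Matrix (Fin qc) (Fin n) ℝ
  Hc : Matrix (Fin qc) (Fin n) ℝ
  Fc : Matrix (Fin qc) (Fin pc) ℝ
  J : Matrix (Fin n) (Fin n) ℝ
  Gd : Matrix (Fin n) (Fin n) ℝ
  Ed : Matrix (Fin n) (Fin pd) ℝ
  Cd : Matrix (Fin qd) (Fin n) ℝ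
  Hd : Matrix (Fin qd) (Fin n) ℝ
  Fd : Matrix (Fin qd) (Fin pd) ℝ
  continuousOn_A : ContinuousOn A (Set.Ici 0)
  continuousOn_Gc : ContinuousOn Gc (Set.Ici 0)
  continuousOn_Ec : ContinuousOn Ec (Set.Ici 0)

/-- The vector 1-norm on `ℝ^m`. -/
def l1norm {m : ℕ} (v : Fin m → ℝ) : ℝ := ∑ i, |v i|

/-- The impulse times `t_0 = 0`, `t_{k+1} = t_k + T_k` of a dwell-time sequence `T`. -/
def impulseTime (T : ℕ → ℝ) (k : ℕ) : ℝ := ∑ i ∈ Finset.range k, T i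

/-- Standing assumption on dwell-time sequences: `T_k > 0` for all `k`, and `t_k → ∞`. -/
def IsDwellSequence (T : ℕ → ℝ) : Prop :=
  (∀ k, 0 < T k) ∧ Tendsto (impulseTime T) atTop atTop

/-- The `q`-periodic dwell-time sequences with `T_k ≥ Tbar` whose sum over one period is `hc / α`
for some positive integer `α`. -/
def periodicMinDwell (Tbar hc : ℝ) : Set (ℕ → ℝ) :=
  {T | ∃ q α : ℕ, 0 < q ∧ 0 < α ∧
    (∃ β : ℕ → ℝ, ∀ k < q, Tbar ≤ β k ∧ ∀ i, T (q * i + k) = β k) ∧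
    ∑ i ∈ Finset.range q, T i = hc / α}

namespace ImpulsiveDelaySystem

variable {n pc pd qc qd : ℕ}

/-- The sampled delayed state `x(t_{k-hd})`. For `k < hd` the index is negative and the value is
prescribed by the initial data: `ψ j` stands for `x(t_{-j})`, `1 ≤ j < hd`. -/
def sampledDelay (hd : ℕ) (T : ℕ → ℝ) (ψ : ℕ → Fin n → ℝ) (x : ℝ → Fin n → ℝ) (k : ℕ) :
    Fin n → ℝ :=
  if hd ≤ k then x (impulseTime T (k - hd)) else ψ (hd - k)

/-- The right-hand side of the flow equation at time `t_k + τ`. -/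
def flowField (S : ImpulsiveDelaySystem n pc pd qc qd) (hc : ℝ) (T : ℕ → ℝ)
    (wc : ℝ → Fin pc → ℝ) (x : ℝ → Fin n → ℝ) (k : ℕ) (τ : ℝ) : Fin n → ℝ :=
  S.A τ *ᵥ x (impulseTime T k + τ) + S.Gc τ *ᵥ x (impulseTime T k + τ - hc)
    + S.Ec τ *ᵥ wc (impulseTime T k + τ)

/-- The state `x(t_k⁺)` from which the flow starts after the `k`-th impulse; there is no jump at
`t_0 = 0`. -/
def postJump (S : ImpulsiveDelaySystem n pc pd qc qd) (hd : ℕ) (T : ℕ → ℝ)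
    (ψ : ℕ → Fin n → ℝ) (wd : ℕ → Fin pd → ℝ) (x : ℝ → Fin n → ℝ) (k : ℕ) : Fin n → ℝ :=
  if k = 0 then x 0
  else S.J *ᵥ x (impulseTime T k) + S.Gd *ᵥ sampledDelay hd T ψ x k + S.Ed *ᵥ wd k

/-- `x : [-hc, ∞) → ℝ^n` is the (Carathéodory) solution for the delays `hc`, `hd`, the dwell-time
sequence `T`, the initial function `φ` on `[-hc, 0]`, the initial samples `ψ`, and the inputs
`wc`, `wd`: on every interval `(t_k, t_{k+1}]` it satisfies the flow equation in integrated form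
(that is, it is absolutely continuous and satisfies the equation almost everywhere) and starts from
`x(t_k⁺)`. It is continuous from the left, `x(t_k)` being the value just before the impulse. -/
structure IsSolution (S : ImpulsiveDelaySystem n pc pd qc qd) (hc : ℝ) (hd : ℕ) (T : ℕ → ℝ)
    (φ : ℝ → Fin n → ℝ) (ψ : ℕ → Fin n → ℝ) (wc : ℝ → Fin pc → ℝ) (wd : ℕ → Fin pd → ℝ)
    (x : ℝ → Fin n → ℝ) : Prop where
  initial : ∀ s ∈ Set.Icc (-hc) 0, x s = φ s
  integrable : ∀ k, IntervalIntegrable (S.flowField hc T wc x k) volume 0 (T k)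
  flow : ∀ k, ∀ τ ∈ Set.Ioc 0 (T k),
    x (impulseTime T k + τ)
      = S.postJump hd T ψ wd x k + ∫ s in (0 : ℝ)..τ, S.flowField hc T wc x k s

/-- The continuous-time output `z_c(t)`, `t > 0`. -/
def outputC (S : ImpulsiveDelaySystem n pc pd qc qd) (hc : ℝ)
    (wc : ℝ → Fin pc → ℝ) (x : ℝ → Fin n → ℝ) (t : ℝ) : Fin qc → ℝ :=
  S.Cc *ᵥ x t + S.Hc *ᵥ x (t - hc) + S.Fc *ᵥ wc t

/-- The discrete-time output `z_d(k)`, `k ≥ 1`. -/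
def outputD (S : ImpulsiveDelaySystem n pc pd qc qd) (hd : ℕ) (T : ℕ → ℝ)
    (ψ : ℕ → Fin n → ℝ) (wd : ℕ → Fin pd → ℝ) (x : ℝ → Fin n → ℝ) (k : ℕ) : Fin qd → ℝ :=
  S.Cd *ᵥ x (impulseTime T k) + S.Hd *ᵥ sampledDelay hd T ψ x k + S.Fd *ᵥ wd k

/-- Internal positivity: whatever the delays and the impulse times, nonnegative initial data and
nonnegative inputs produce a nonnegative state and nonnegative outputs. -/
def InternallyPositive (S : ImpulsiveDelaySystem n pc pd qc qd) : Prop :=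
  ∀ (hc : ℝ) (hd : ℕ) (T : ℕ → ℝ), 0 < hc → IsDwellSequence T →
  ∀ (φ : ℝ → Fin n → ℝ) (ψ : ℕ → Fin n → ℝ) (wc : ℝ → Fin pc → ℝ) (wd : ℕ → Fin pd → ℝ)
    (x : ℝ → Fin n → ℝ),
    ContinuousOn φ (Set.Icc (-hc) 0) → LocallyIntegrableOn wc (Set.Ici 0) →
    (∀ s ∈ Set.Icc (-hc) 0, 0 ≤ φ s) → (∀ j, 0 ≤ ψ j) →
    (∀ t, 0 ≤ t → 0 ≤ wc t) → (∀ k, 0 ≤ wd k) →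
    S.IsSolution hc hd T φ ψ wc wd x →
    (∀ t, 0 ≤ t → 0 ≤ x t) ∧ (∀ t, 0 < t → 0 ≤ S.outputC hc wc x t) ∧
      ∀ k, 1 ≤ k → 0 ≤ S.outputD hd T ψ wd x k

/-- The size of the initial data: the supremum norm of `φ` on `[-hc, 0]` plus the norms of the
samples `ψ 1, …, ψ (hd - 1)`. -/
noncomputable def initialNorm (hc : ℝ) (hd : ℕ) (φ : ℝ → Fin n → ℝ) (ψ : ℕ → Fin n → ℝ) : ℝ :=
  (⨆ s : Set.Icc (-hc) 0, l1norm (φ s)) + ∑ j ∈ Finset.Ico 1 hd, l1norm (ψ j)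

/-- (Global) asymptotic stability of the system without inputs, for given delays and a given
dwell-time sequence: Lyapunov stability and attractivity of the origin. -/
def AsymptoticallyStable (S : ImpulsiveDelaySystem n pc pd qc qd) (hc : ℝ) (hd : ℕ)
    (T : ℕ → ℝ) : Prop :=
  (∀ η : ℝ, 0 < η → ∃ δ : ℝ, 0 < δ ∧
    ∀ (φ : ℝ → Fin n → ℝ) (ψ : ℕ → Fin n → ℝ) (x : ℝ → Fin n → ℝ),
      ContinuousOn φ (Set.Icc (-hc) 0) → S.IsSolution hc hd T φ ψ 0 0 x →
      initialNorm hc hd φ ψ < δ → ∀ t, 0 ≤ t → l1norm (x t) < η) ∧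
  ∀ (φ : ℝ → Fin n → ℝ) (ψ : ℕ → Fin n → ℝ) (x : ℝ → Fin n → ℝ),
    ContinuousOn φ (Set.Icc (-hc) 0) → S.IsSolution hc hd T φ ψ 0 0 x →
    Tendsto x atTop (𝓝 0)

/-- The map `(w_c, w_d) ↦ (z_c, z_d)` has a hybrid `L₁/ℓ₁`-gain of at most `γ`, for given delays
and a given dwell-time sequence: for inputs in `L₁` and `ℓ₁` the outputs are in `L₁` and `ℓ₁`, and
`‖z_c‖ + ‖z_d‖ ≤ γ (‖w_c‖ + ‖w_d‖) + v(‖initial data‖)`. The discrete-time signals are indexed by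
`k ≥ 1`. -/
def HybridGainLE (S : ImpulsiveDelaySystem n pc pd qc qd) (hc : ℝ) (hd : ℕ)
    (T : ℕ → ℝ) (γ : ℝ) : Prop :=
  ∃ v : ℝ → ℝ, StrictMonoOn v (Set.Ici 0) ∧ v 0 = 0 ∧ Tendsto v atTop atTop ∧
    ∀ (φ : ℝ → Fin n → ℝ) (ψ : ℕ → Fin n → ℝ) (wc : ℝ → Fin pc → ℝ) (wd : ℕ → Fin pd → ℝ)
      (x : ℝ → Fin n → ℝ),
      ContinuousOn φ (Set.Icc (-hc) 0) → IntegrableOn wc (Set.Ioi 0) →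
      (Summable fun k => l1norm (wd (k + 1))) →
      S.IsSolution hc hd T φ ψ wc wd x →
      IntegrableOn (S.outputC hc wc x) (Set.Ioi 0) ∧
      (Summable fun k => l1norm (S.outputD hd T ψ wd x (k + 1))) ∧
      (∫ t in Set.Ioi 0, l1norm (S.outputC hc wc x t))
          + ∑' k, l1norm (S.outputD hd T ψ wd x (k + 1))
        ≤ γ * ((∫ t in Set.Ioi 0, l1norm (wc t)) + ∑' k, l1norm (wd (k + 1)))
          + v (initialNorm hc hd φ ψ)

end ImpulsiveDelaySystem

/-! The argument uses a storage functional that is linear in the state. Extend `ζ` beyond `Tbar` by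
its last value to a weight `Z`. To `Z(τ)·x` add the states of the last `hc` time units, weighted by
`delayWeight` (`Z(s)·Gc(s)v + 1·Hc v`), and the last `hd` samples, weighted by `sampleWeight`. The
hypotheses contain `A + Gc` and `J + Gd`, so they treat the delayed state as if it were the current
one. On each dwell interval the change of `Z·x` plus the output is therefore at most `γ` times the
input, plus the weight of the delayed state, minus the weight of the current state.

Periodicity makes these weights cancel. With `N = α q` one has `t_{k+N} = t_k + hc`, so the state at
timer value `τ` in interval `k` returns as the delayed state at the same timer value in interval `k
+ N`. After summation only the first `N` delayed terms, given by the initial function, remain on the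
right. The jumps behave alike with shift `hd`, and they also contribute `ε` times the sum of
`1·x(t_k)`. The result is `exists_storage_bound`.

The cancellation needs the weight of each current piece to be nonnegative, although no sign of `ζ`
inside `(0, Tbar)` is assumed. In `integral_delayWeight_nonneg`, a nonnegative `u` is fed as delayed
signal into a flow starting at `0`. By dissipation, the integral for `u` is at least that for the
response. Iterating, the responses tend to zero like `(E L)^m / m!`.

Since `ζ'` need not be integrable and the state is only absolutely continuous, dissipation rests on
the product inequality `mul_sub_mul_le_integral`.

The storage bound concerns nonnegative solutions. `exists_dominating` transfers it to all solutions,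
by comparison with the solution whose data are the absolute values. The gain follows directly. For
stability, the values at impulse times are summable, and `norm_le_final` bounds a nonnegative flow
inside a dwell interval by its value at the end. -/

/-! ### Grönwall's inequality; matrix-valued functions. -/

/-- Grönwall's inequality in integral form. -/
theorem le_mul_exp_of_le_add_integral {L K c : ℝ} (hK : 0 ≤ K) {N : ℝ → ℝ}
    (hN : ContinuousOn N (Set.Icc 0 L))
    (h : ∀ t ∈ Set.Icc 0 L, N t ≤ c + K * ∫ s in (0 : ℝ)..t, N s) :
    ∀ t ∈ Set.Icc 0 L, N t ≤ c * Real.exp (K * t) := by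
  intro t ht
  have hL : 0 ≤ L := ht.1.trans ht.2
  set R : ℝ → ℝ := fun t => c + K * ∫ s in (0 : ℝ)..t, N s with hR
  have hint : IntervalIntegrable N volume 0 L :=
    ContinuousOn.intervalIntegrable (by rwa [Set.uIcc_of_le hL])
  have hcont : ContinuousOn R (Set.Icc 0 L) := by
    have := intervalIntegral.continuousOn_primitive_interval' (μ := volume) hint Set.left_mem_uIcc
    rw [Set.uIcc_of_le hL] at this
    exact continuousOn_const.add (continuousOn_const.mul this)
  have hder : ∀ s ∈ Set.Ioo 0 L, HasDerivAt R (K * N s) s := by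
    intro s hs
    have hi : IntervalIntegrable N volume 0 s := hint.mono_set (by
      rw [Set.uIcc_of_le hL, Set.uIcc_of_le hs.1.le]; exact Set.Icc_subset_Icc_right hs.2.le)
    have := intervalIntegral.integral_hasDerivAt_right hi
      (hN.mono Set.Ioo_subset_Icc_self |>.stronglyMeasurableAtFilter isOpen_Ioo s hs)
      (hN.continuousAt (Icc_mem_nhds hs.1 hs.2))
    exact (this.const_mul K).const_add c
  -- Integrating factor: `exp (-K s)` times the right-hand side of the hypothesis decreases from
  -- `c`.
  have hanti : AntitoneOn (fun s => Real.exp (-(K * s)) * R s) (Set.Icc 0 L) := by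
    apply antitoneOn_of_hasDerivWithinAt_nonpos (convex_Icc 0 L)
      (f' := fun s => Real.exp (-(K * s)) * (-K) * R s + Real.exp (-(K * s)) * (K * N s))
    · exact (Continuous.continuousOn (by fun_prop)).mul hcont
    · intro s hs
      rw [interior_Icc] at hs
      have h1 : HasDerivAt (fun s => Real.exp (-(K * s))) (Real.exp (-(K * s)) * (-K)) s := by
        have := ((hasDerivAt_id s).const_mul K).neg.exp
        simpa using this
      exact (h1.mul (hder s hs)).hasDerivWithinAt
    · intro s hs
      rw [interior_Icc] at hs
      have := h s (Set.Ioo_subset_Icc_self hs)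
      have h2 : Real.exp (-(K * s)) * (-K) * R s + Real.exp (-(K * s)) * (K * N s)
          = Real.exp (-(K * s)) * (K * (N s - R s)) := by ring
      rw [h2]
      exact mul_nonpos_of_nonneg_of_nonpos (Real.exp_pos _).le
        (mul_nonpos_of_nonneg_of_nonpos hK (sub_nonpos.2 this))
  have h0 := hanti (Set.left_mem_Icc.2 hL) ht ht.1
  simp only [hR, mul_zero, neg_zero, Real.exp_zero, intervalIntegral.integral_same, add_zero,
    one_mul] at h0
  refine (h t ht).trans ?_
  calc _ = Real.exp (K * t) * (Real.exp (-(K * t)) * (c + K * ∫ s in (0 : ℝ)..t, N s)) := by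
        rw [← mul_assoc, ← Real.exp_add]; simp
    _ ≤ Real.exp (K * t) * c := by gcongr
    _ = _ := mul_comm _ _

/-- A continuous family of matrices on a compact set is uniformly bounded. -/
theorem exists_norm_mulVec_le {m n : ℕ} {A : ℝ → Matrix (Fin m) (Fin n) ℝ} {s : Set ℝ}
    (hs : IsCompact s) (hA : ContinuousOn A s) :
    ∃ K, 0 ≤ K ∧ ∀ t ∈ s, ∀ v, ‖A t *ᵥ v‖ ≤ K * ‖v‖ := by
  have hent : ∀ i j, ContinuousOn (fun t => A t i j) s := fun i j =>
    (continuous_apply_apply i j).comp_continuousOn hA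
  have hc : ContinuousOn (fun t => ∑ i, ∑ j, |A t i j|) s :=
    continuousOn_finsetSum _ fun i _ => continuousOn_finsetSum _ fun j _ => (hent i j).abs
  obtain ⟨K, hK⟩ := hs.bddAbove_image hc
  refine ⟨max K 0, le_max_right _ _, fun t ht v => ?_⟩
  rw [pi_norm_le_iff_of_nonneg (by positivity)]
  intro i
  calc ‖(A t *ᵥ v) i‖ = |∑ j, A t i j * v j| := rfl
    _ ≤ ∑ j, |A t i j * v j| := Finset.abs_sum_le_sum_abs _ _
    _ ≤ ∑ j, |A t i j| * ‖v‖ := by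
        gcongr with j
        rw [abs_mul]; gcongr
        exact norm_le_pi_norm v j
    _ = (∑ j, |A t i j|) * ‖v‖ := by rw [Finset.sum_mul]
    _ ≤ max K 0 * ‖v‖ := by
        gcongr
        refine le_trans ?_ (le_max_left _ _)
        refine le_trans ?_ (hK ⟨t, ht, rfl⟩)
        exact Finset.single_le_sum (f := fun i => ∑ j, |A t i j|)
          (fun i _ => Finset.sum_nonneg fun j _ => abs_nonneg _) (Finset.mem_univ i)

theorem ContinuousOn.mulVec {m n : ℕ} {A : ℝ → Matrix (Fin m) (Fin n) ℝ} {y : ℝ → Fin n → ℝ}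
    {s : Set ℝ} (hA : ContinuousOn A s) (hy : ContinuousOn y s) :
    ContinuousOn (fun t => A t *ᵥ y t) s := by
  refine continuousOn_pi.2 fun i => ?_
  refine continuousOn_finsetSum (f := fun j t => A t i j * y t j) Finset.univ fun j _ => ?_
  exact ((continuous_apply_apply i j).comp_continuousOn hA).mul
    ((continuous_apply j).comp_continuousOn hy)

/-- Continuous matrix times integrable vector function. -/
theorem MeasureTheory.IntegrableOn.mulVec {m n : ℕ} {A : ℝ → Matrix (Fin m) (Fin n) ℝ}
    {y : ℝ → Fin n → ℝ} {a b : ℝ} (hA : ContinuousOn A (Set.Icc a b))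
    (hy : IntegrableOn y (Set.Icc a b)) :
    IntegrableOn (fun t => A t *ᵥ y t) (Set.Icc a b) := by
  refine Integrable.of_eval fun i => ?_
  refine integrable_finsetSum (f := fun j t => A t i j * y t j) Finset.univ fun j _ => ?_
  exact IntegrableOn.continuousOn_mul ((continuous_apply_apply i j).comp_continuousOn hA)
    (hy.eval j) isCompact_Icc

theorem IntervalIntegrable.mulVec {m n : ℕ} {A : ℝ → Matrix (Fin m) (Fin n) ℝ}
    {y : ℝ → Fin n → ℝ} {a b : ℝ} (hab : a ≤ b) (hA : ContinuousOn A (Set.Icc a b))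
    (hy : IntervalIntegrable y volume a b) :
    IntervalIntegrable (fun t => A t *ᵥ y t) volume a b := by
  rw [intervalIntegrable_iff_integrableOn_Icc_of_le hab] at *
  exact hy.mulVec hA

/-! ### Linear flows with integrable forcing: existence, uniqueness, growth. -/

/-- `y` solves `y' = A y + f`, `y 0 = x0` on `[0, L]`, in integrated form. -/
structure IsFlow {n : ℕ} (A : ℝ → Matrix (Fin n) (Fin n) ℝ) (L : ℝ) (x0 : Fin n → ℝ)
    (f y : ℝ → Fin n → ℝ) : Prop where
  cont : ContinuousOn y (Set.Icc 0 L)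
  eq : ∀ t ∈ Set.Icc 0 L, y t = x0 + ∫ s in (0 : ℝ)..t, (A s *ᵥ y s + f s)

theorem intervalIntegrable_left_of_mem {E : Type*} [NormedAddCommGroup E] {f : ℝ → E} {L t : ℝ}
    (hf : IntervalIntegrable f volume 0 L) (ht : t ∈ Set.Icc 0 L) :
    IntervalIntegrable f volume 0 t :=
  hf.mono_set (by
    rw [Set.uIcc_of_le (ht.1.trans ht.2), Set.uIcc_of_le ht.1]; exact Set.Icc_subset_Icc_right ht.2)

theorem intervalIntegrable_right_of_mem {E : Type*} [NormedAddCommGroup E] {f : ℝ → E} {L t : ℝ}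
    (hf : IntervalIntegrable f volume 0 L) (ht : t ∈ Set.Icc 0 L) :
    IntervalIntegrable f volume t L :=
  hf.mono_set (by
    rw [Set.uIcc_of_le (ht.1.trans ht.2), Set.uIcc_of_le ht.2]; exact Set.Icc_subset_Icc_left ht.1)

theorem ContinuousOn.intervalIntegrable_zero {E : Type*} [NormedAddCommGroup E] {f : ℝ → E} {L : ℝ}
    (hL : 0 ≤ L) (hf : ContinuousOn f (Set.Icc 0 L)) : IntervalIntegrable f volume 0 L :=
  ContinuousOn.intervalIntegrable (by rwa [Set.uIcc_of_le hL])

/-- Coordinatewise truncation to `[-R, R]`. -/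
def clampVec {n : ℕ} (R : ℝ) (v : Fin n → ℝ) : Fin n → ℝ := fun i => max (-R) (min (v i) R)

theorem norm_clampVec_sub_le {n : ℕ} (R : ℝ) (v w : Fin n → ℝ) :
    ‖clampVec R v - clampVec R w‖ ≤ ‖v - w‖ := by
  rw [pi_norm_le_iff_of_nonneg (norm_nonneg _)]
  intro i
  refine le_trans ?_ (norm_le_pi_norm (v - w) i)
  simp only [clampVec, Pi.sub_apply, Real.norm_eq_abs]
  refine (abs_max_sub_max_le_max _ _ _ _).trans ?_
  refine max_le (by simp) ((abs_min_sub_min_le_max _ _ _ _).trans (by simp))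

theorem norm_clampVec_le {n : ℕ} {R : ℝ} (hR : 0 ≤ R) (v : Fin n → ℝ) :
    ‖clampVec R v‖ ≤ R := by
  rw [pi_norm_le_iff_of_nonneg hR]
  intro i
  simp only [clampVec, Real.norm_eq_abs, abs_le]
  exact ⟨le_max_left _ _, max_le (by linarith) (min_le_right _ _)⟩

theorem norm_clampVec_le_norm {n : ℕ} {R : ℝ} (hR : 0 ≤ R) (v : Fin n → ℝ) :
    ‖clampVec R v‖ ≤ ‖v‖ := by
  have h0 : clampVec R (0 : Fin n → ℝ) = 0 := by
    ext i; simp [clampVec, hR]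
  simpa [h0] using norm_clampVec_sub_le R v 0

theorem clampVec_eq_self {n : ℕ} {R : ℝ} {v : Fin n → ℝ} (hv : ‖v‖ ≤ R) : clampVec R v = v := by
  ext i
  have := abs_le.1 ((norm_le_pi_norm v i).trans hv)
  simp [clampVec, this.1, this.2]

theorem continuous_clampVec {n : ℕ} (R : ℝ) : Continuous (clampVec R : (Fin n → ℝ) → Fin n → ℝ) := by
  unfold clampVec; fun_prop

/-- The forcing is merely integrable, so Picard–Lindelöf is applied to `y - F`, where `F` is the
primitive of `f`: its equation has a right-hand side continuous in time. Truncating the argument at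
an a priori bound makes that field bounded, hence solvable on all of `[0, L]`, and the truncation
turns out never to act. -/
theorem exists_isFlow {n : ℕ} {A : ℝ → Matrix (Fin n) (Fin n) ℝ} {L : ℝ} (hL : 0 ≤ L)
    (hA : ContinuousOn A (Set.Icc 0 L)) (x0 : Fin n → ℝ) {f : ℝ → Fin n → ℝ}
    (hf : IntervalIntegrable f volume 0 L) : ∃ y, IsFlow A L x0 f y := by
  obtain ⟨K, hK, hAK⟩ := exists_norm_mulVec_le isCompact_Icc hA
  set F : ℝ → Fin n → ℝ := fun t => ∫ s in (0 : ℝ)..t, f s with hF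
  have hFc : ContinuousOn F (Set.Icc 0 L) := by
    have := intervalIntegral.continuousOn_primitive_interval' (μ := volume) hf Set.left_mem_uIcc
    rwa [Set.uIcc_of_le hL] at this
  obtain ⟨B, hB⟩ := isCompact_Icc.exists_bound_of_continuousOn hFc
  have hB0 : 0 ≤ B := (norm_nonneg _).trans (hB 0 ⟨le_rfl, hL⟩)
  -- The Grönwall bound for `y + F`. It holds for the truncated equation too, because truncation
  -- does not increase norms.
  set R : ℝ := (‖x0‖ + B) * Real.exp (K * L) with hR
  have hR0 : 0 ≤ R := by positivity
  set v : ℝ → (Fin n → ℝ) → Fin n → ℝ := fun t y => A t *ᵥ clampVec R (y + F t) with hv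
  have hPL : IsPicardLindelof v (tmin := 0) (tmax := L) ⟨0, le_rfl, hL⟩ x0
      ⟨K * R * L, by positivity⟩ 0 ⟨K * R, by positivity⟩ ⟨K, hK⟩ := by
    constructor
    · intro t ht
      refine LipschitzOnWith.of_dist_le_mul fun y _ z _ => ?_
      rw [dist_eq_norm, dist_eq_norm]
      simp only [hv, ← mulVec_sub]
      refine (hAK t ht _).trans ?_
      refine mul_le_mul_of_nonneg_left ?_ hK
      refine (norm_clampVec_sub_le _ _ _).trans ?_
      simp
    · intro y _
      exact hA.mulVec ((continuous_clampVec R).comp_continuousOn (continuousOn_const.add hFc))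
    · intro t ht y _
      exact (hAK t ht _).trans (mul_le_mul_of_nonneg_left (norm_clampVec_le hR0 _) hK)
    · simp only [sub_zero, sub_self, max_eq_left hL, NNReal.coe_zero]
      exact le_rfl
  obtain ⟨y, hy0, hy⟩ := hPL.exists_eq_forall_mem_Icc_hasDerivWithinAt₀
  have hyc : ContinuousOn y (Set.Icc 0 L) := fun t ht => (hy t ht).continuousWithinAt
  have hvc : ContinuousOn (fun t => v t (y t)) (Set.Icc 0 L) :=
    hA.mulVec ((continuous_clampVec R).comp_continuousOn (hyc.add hFc))
  have hvi := hvc.intervalIntegrable_zero hL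
  have hyeq : ∀ t ∈ Set.Icc 0 L, y t = x0 + ∫ s in (0 : ℝ)..t, v s (y s) := by
    intro t ht
    rw [intervalIntegral.integral_eq_sub_of_hasDerivAt_of_le ht.1
      (hyc.mono (Set.Icc_subset_Icc_right ht.2)) (fun s hs => ?_)
      (intervalIntegrable_left_of_mem hvi ht)]
    · rw [show y 0 = x0 from hy0]; abel
    · exact (hy s ⟨hs.1.le, hs.2.le.trans ht.2⟩).hasDerivAt
        (Icc_mem_nhds hs.1 (hs.2.trans_le ht.2))
  have hbound : ∀ t ∈ Set.Icc 0 L, ‖y t + F t‖ ≤ R := by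
    intro t ht
    refine (le_mul_exp_of_le_add_integral (c := ‖x0‖ + B) hK (hyc.add hFc).norm ?_ t ht).trans ?_
    · intro t ht
      simp only [Pi.add_apply]
      rw [hyeq t ht]
      have h1 : ‖∫ s in (0 : ℝ)..t, v s (y s)‖ ≤ K * ∫ s in (0 : ℝ)..t, ‖y s + F s‖ := by
        rw [← intervalIntegral.integral_const_mul]
        refine intervalIntegral.norm_integral_le_of_norm_le ht.1 ?_
          ((intervalIntegrable_left_of_mem
            ((hyc.add hFc).norm.intervalIntegrable_zero hL) ht).const_mul K)
        refine Eventually.of_forall fun s hs => (hAK s ⟨hs.1.le, hs.2.trans ht.2⟩ _).trans ?_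
        exact mul_le_mul_of_nonneg_left (norm_clampVec_le_norm hR0 _) hK
      have h2 := hB t ht
      calc _ ≤ ‖x0‖ + ‖∫ s in (0 : ℝ)..t, v s (y s)‖ + ‖F t‖ := norm_add₃_le
        _ ≤ _ := by linarith
    · rw [hR]
      gcongr
      exact ht.2
  refine ⟨fun t => y t + F t, hyc.add hFc, fun t ht => ?_⟩
  have hAy := (hA.mulVec (hyc.add hFc)).intervalIntegrable_zero hL
  have hint := intervalIntegral.integral_add (intervalIntegrable_left_of_mem hAy ht)
    (intervalIntegrable_left_of_mem hf ht)
  simp only [Pi.add_apply] at hint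
  rw [hyeq t ht, hint, add_assoc]
  congr 2
  refine intervalIntegral.integral_congr fun s hs => ?_
  rw [Set.uIcc_of_le ht.1] at hs
  simp only [hv]
  rw [clampVec_eq_self (hbound s ⟨hs.1, hs.2.trans ht.2⟩)]

theorem IsFlow.add {n : ℕ} {A : ℝ → Matrix (Fin n) (Fin n) ℝ} {L : ℝ} (hL : 0 ≤ L)
    (hA : ContinuousOn A (Set.Icc 0 L)) {x0 x1 : Fin n → ℝ} {f g y z : ℝ → Fin n → ℝ}
    (hf : IntervalIntegrable f volume 0 L) (hg : IntervalIntegrable g volume 0 L)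
    (hy : IsFlow A L x0 f y) (hz : IsFlow A L x1 g z) :
    IsFlow A L (x0 + x1) (f + g) (y + z) := by
  refine ⟨hy.cont.add hz.cont, fun t ht => ?_⟩
  have h1 := ((hA.mulVec hy.cont).intervalIntegrable_zero hL).add hf
  have h2 := ((hA.mulVec hz.cont).intervalIntegrable_zero hL).add hg
  rw [Pi.add_apply, hy.eq t ht, hz.eq t ht, add_add_add_comm, ← intervalIntegral.integral_add
    (intervalIntegrable_left_of_mem h1 ht) (intervalIntegrable_left_of_mem h2 ht)]
  congr 2
  ext s i
  simp [mulVec_add]; ring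

theorem IsFlow.neg {n : ℕ} {A : ℝ → Matrix (Fin n) (Fin n) ℝ} {L : ℝ}
    {x0 : Fin n → ℝ} {f y : ℝ → Fin n → ℝ}
    (hy : IsFlow A L x0 f y) : IsFlow A L (-x0) (-f) (-y) := by
  refine ⟨hy.cont.neg, fun t ht => ?_⟩
  rw [Pi.neg_apply, hy.eq t ht, neg_add, ← intervalIntegral.integral_neg]
  congr 2
  ext s i
  simp [mulVec_neg]; ring

theorem IsFlow.sub {n : ℕ} {A : ℝ → Matrix (Fin n) (Fin n) ℝ} {L : ℝ} (hL : 0 ≤ L)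
    (hA : ContinuousOn A (Set.Icc 0 L)) {x0 x1 : Fin n → ℝ} {f g y z : ℝ → Fin n → ℝ}
    (hf : IntervalIntegrable f volume 0 L) (hg : IntervalIntegrable g volume 0 L)
    (hy : IsFlow A L x0 f y) (hz : IsFlow A L x1 g z) :
    IsFlow A L (x0 - x1) (f - g) (y - z) := by
  simpa only [sub_eq_add_neg] using hy.add hL hA hf hg.neg hz.neg

/-- Forward growth bound. -/
theorem IsFlow.norm_le {n : ℕ} {A : ℝ → Matrix (Fin n) (Fin n) ℝ} {L K : ℝ}
    {x0 : Fin n → ℝ} {f y : ℝ → Fin n → ℝ} (hK : 0 ≤ K)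
    (hA : ContinuousOn A (Set.Icc 0 L))
    (hAK : ∀ t ∈ Set.Icc 0 L, ∀ v, ‖A t *ᵥ v‖ ≤ K * ‖v‖)
    (hf : IntervalIntegrable f volume 0 L) (hy : IsFlow A L x0 f y) :
    ∀ t ∈ Set.Icc 0 L, ‖y t‖ ≤ (‖x0‖ + ∫ s in (0 : ℝ)..t, ‖f s‖) * Real.exp (K * t) := by
  intro T hT
  refine le_mul_exp_of_le_add_integral (L := T) hK
    ((hy.cont.mono (Set.Icc_subset_Icc_right hT.2)).norm) ?_ T ⟨hT.1, le_rfl⟩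
  intro t ht
  have htL : t ∈ Set.Icc 0 L := ⟨ht.1, ht.2.trans hT.2⟩
  have hL := hT.1.trans hT.2
  have hyi := hy.cont.intervalIntegrable_zero hL
  have hAy := (hA.mulVec hy.cont).intervalIntegrable_zero hL
  rw [hy.eq t htL, intervalIntegral.integral_add (intervalIntegrable_left_of_mem hAy htL)
    (intervalIntegrable_left_of_mem hf htL)]
  have h1 : ‖∫ s in (0 : ℝ)..t, A s *ᵥ y s‖ ≤ K * ∫ s in (0 : ℝ)..t, ‖y s‖ := by
    rw [← intervalIntegral.integral_const_mul]
    refine intervalIntegral.norm_integral_le_of_norm_le ht.1 ?_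
      ((intervalIntegrable_left_of_mem hyi.norm htL).const_mul K)
    exact Eventually.of_forall fun s hs => hAK s ⟨hs.1.le, hs.2.trans htL.2⟩ _
  have h2 : ‖∫ s in (0 : ℝ)..t, f s‖ ≤ ∫ s in (0 : ℝ)..t, ‖f s‖ :=
    intervalIntegral.norm_integral_le_integral_norm ht.1
  have h3 : ∫ s in (0 : ℝ)..t, ‖f s‖ ≤ ∫ s in (0 : ℝ)..T, ‖f s‖ := by
    refine intervalIntegral.integral_mono_interval le_rfl ht.1 ht.2 ?_
      (intervalIntegrable_left_of_mem hf hT).norm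
    exact Eventually.of_forall fun s => norm_nonneg _
  calc _ ≤ ‖x0‖ + (‖∫ s in (0 : ℝ)..t, A s *ᵥ y s‖ + ‖∫ s in (0 : ℝ)..t, f s‖) :=
        (norm_add_le _ _).trans (add_le_add_right (norm_add_le _ _) _)
    _ ≤ _ := by linarith

theorem IsFlow.eqOn {n : ℕ} {A : ℝ → Matrix (Fin n) (Fin n) ℝ} {L : ℝ}
    (hA : ContinuousOn A (Set.Icc 0 L)) {x0 : Fin n → ℝ} {f y z : ℝ → Fin n → ℝ}
    (hf : IntervalIntegrable f volume 0 L)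
    (hy : IsFlow A L x0 f y) (hz : IsFlow A L x0 f z) : Set.EqOn y z (Set.Icc 0 L) := by
  intro t ht
  obtain ⟨K, hK, hAK⟩ := exists_norm_mulVec_le isCompact_Icc hA
  have hd := hy.sub (ht.1.trans ht.2) hA hf hf hz
  have := hd.norm_le hK hA hAK (hf.sub hf) t ht
  simp only [sub_self, norm_zero, intervalIntegral.integral_zero, add_zero,
    zero_mul, Pi.sub_apply] at this
  exact sub_eq_zero.1 (norm_le_zero_iff.1 this)

/-- Growth bound backward in time. -/
theorem IsFlow.norm_le_backward {n : ℕ} {A : ℝ → Matrix (Fin n) (Fin n) ℝ} {L K : ℝ}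
    {x0 : Fin n → ℝ} {f y : ℝ → Fin n → ℝ} (hK : 0 ≤ K)
    (hA : ContinuousOn A (Set.Icc 0 L))
    (hAK : ∀ t ∈ Set.Icc 0 L, ∀ v, ‖A t *ᵥ v‖ ≤ K * ‖v‖)
    (hf : IntervalIntegrable f volume 0 L) (hy : IsFlow A L x0 f y) :
    ∀ t ∈ Set.Icc 0 L, ‖y t‖ ≤ (‖y L‖ + ∫ s in t..L, ‖f s‖) * Real.exp (K * (L - t)) := by
  intro T hT
  have hL := hT.1.trans hT.2
  have hmap : ∀ s ∈ Set.Icc 0 (L - T), L - s ∈ Set.Icc 0 L := fun s hs =>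
    ⟨by linarith [hs.2, hT.1], by linarith [hs.1]⟩
  -- Forward Grönwall in the reversed time `L - s`.
  have key := le_mul_exp_of_le_add_integral (L := L - T) hK (N := fun s => ‖y (L - s)‖)
    (c := ‖y L‖ + ∫ s in T..L, ‖f s‖)
    ((hy.cont.comp (Continuous.continuousOn (by fun_prop)) hmap).norm) ?_ (L - T)
    ⟨by linarith [hT.2], le_rfl⟩
  · simpa using key
  intro r hr
  have htL : L - r ∈ Set.Icc 0 L := hmap r hr
  have hyi := hy.cont.intervalIntegrable_zero hL
  have hAy := (hA.mulVec hy.cont).intervalIntegrable_zero hL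
  have hLL : L ∈ Set.Icc 0 L := ⟨hL, le_rfl⟩
  have e1 : y (L - r) = y L - ∫ s in (L - r)..L, (A s *ᵥ y s + f s) := by
    rw [hy.eq _ htL, hy.eq L hLL, ← intervalIntegral.integral_add_adjacent_intervals
      (intervalIntegrable_left_of_mem (hAy.add hf) htL)
      (intervalIntegrable_right_of_mem (hAy.add hf) htL)]
    abel
  rw [e1, intervalIntegral.integral_add (intervalIntegrable_right_of_mem hAy htL)
    (intervalIntegrable_right_of_mem hf htL)]
  have e2 : ∫ s in (0 : ℝ)..r, ‖y (L - s)‖ = ∫ s in (L - r)..L, ‖y s‖ := by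
    rw [intervalIntegral.integral_comp_sub_left (fun s => ‖y s‖)]; simp
  rw [e2]
  have h1 : ‖∫ s in (L - r)..L, A s *ᵥ y s‖ ≤ K * ∫ s in (L - r)..L, ‖y s‖ := by
    rw [← intervalIntegral.integral_const_mul]
    refine intervalIntegral.norm_integral_le_of_norm_le htL.2 ?_
      ((intervalIntegrable_right_of_mem hyi.norm htL).const_mul K)
    exact Eventually.of_forall fun s hs => hAK s ⟨htL.1.trans hs.1.le, hs.2⟩ _
  have h2 : ‖∫ s in (L - r)..L, f s‖ ≤ ∫ s in (L - r)..L, ‖f s‖ :=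
    intervalIntegral.norm_integral_le_integral_norm htL.2
  have h3 : ∫ s in (L - r)..L, ‖f s‖ ≤ ∫ s in T..L, ‖f s‖ := by
    refine intervalIntegral.integral_mono_interval (by linarith [hr.2]) htL.2 le_rfl ?_
      (intervalIntegrable_right_of_mem hf hT).norm
    exact Eventually.of_forall fun s => norm_nonneg _
  calc _ ≤ ‖y L‖ + (‖∫ s in (L - r)..L, A s *ᵥ y s‖ + ‖∫ s in (L - r)..L, f s‖) :=
        (norm_sub_le _ _).trans (add_le_add_right (norm_add_le _ _) _)
    _ ≤ _ := by linarith

/-! ### Impulse times. -/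

theorem impulseTime_zero (T : ℕ → ℝ) : impulseTime T 0 = 0 := by simp [impulseTime]

theorem impulseTime_succ (T : ℕ → ℝ) (k : ℕ) :
    impulseTime T (k + 1) = impulseTime T k + T k := by simp [impulseTime, Finset.sum_range_succ]

theorem IsDwellSequence.strictMono {T : ℕ → ℝ} (hT : IsDwellSequence T) :
    StrictMono (impulseTime T) :=
  strictMono_nat_of_lt_succ fun k => by rw [impulseTime_succ]; linarith [hT.1 k]

theorem IsDwellSequence.impulseTime_nonneg {T : ℕ → ℝ} (hT : IsDwellSequence T) (k : ℕ) :
    0 ≤ impulseTime T k := by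
  rw [← impulseTime_zero T]; exact hT.strictMono.monotone (Nat.zero_le k)

/-- Every positive time lies in exactly one dwell interval. -/
theorem IsDwellSequence.exists_mem_Ioc {T : ℕ → ℝ} (hT : IsDwellSequence T) {t : ℝ} (ht : 0 < t) :
    ∃ k, ∃ τ ∈ Set.Ioc 0 (T k), t = impulseTime T k + τ := by
  classical
  have hex : ∃ k, t ≤ impulseTime T k := (hT.2.eventually_ge_atTop t).exists
  obtain ⟨m, hm⟩ : ∃ m, Nat.find hex = m + 1 := by
    refine Nat.exists_eq_succ_of_ne_zero fun h => ?_
    have := Nat.find_spec hex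
    rw [h, impulseTime_zero] at this
    linarith
  have h1 := Nat.find_spec hex
  have h2 := Nat.find_min hex (m := m) (by omega)
  rw [hm, impulseTime_succ] at h1
  exact ⟨m, t - impulseTime T m, ⟨by linarith, by linarith⟩, by ring⟩

/-! ### Existence by the method of steps; superposition; pieces of a solution. -/

namespace ImpulsiveDelaySystem

variable {n pc pd qc qd : ℕ} (S : ImpulsiveDelaySystem n pc pd qc qd)

/-- The terms of the flow equation which do not involve the current state. -/
def forcing (hc : ℝ) (T : ℕ → ℝ) (wc : ℝ → Fin pc → ℝ) (x : ℝ → Fin n → ℝ) (k : ℕ) (τ : ℝ) :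
    Fin n → ℝ :=
  S.Gc τ *ᵥ x (impulseTime T k + τ - hc) + S.Ec τ *ᵥ wc (impulseTime T k + τ)

theorem flowField_eq (hc : ℝ) (T : ℕ → ℝ) (wc : ℝ → Fin pc → ℝ) (x : ℝ → Fin n → ℝ) (k : ℕ)
    (τ : ℝ) : S.flowField hc T wc x k τ
      = S.A τ *ᵥ x (impulseTime T k + τ) + S.forcing hc T wc x k τ := by
  simp [flowField, forcing, add_assoc]

theorem continuousOn_A_Icc (L : ℝ) : ContinuousOn S.A (Set.Icc 0 L) :=
  S.continuousOn_A.mono Set.Icc_subset_Ici_self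

theorem continuousOn_Gc_Icc (L : ℝ) : ContinuousOn S.Gc (Set.Icc 0 L) :=
  S.continuousOn_Gc.mono Set.Icc_subset_Ici_self

theorem continuousOn_Ec_Icc (L : ℝ) : ContinuousOn S.Ec (Set.Icc 0 L) :=
  S.continuousOn_Ec.mono Set.Icc_subset_Ici_self

theorem intervalIntegrable_input_shift {T : ℕ → ℝ} (hT : IsDwellSequence T) {p : ℕ}
    {wc : ℝ → Fin p → ℝ} (hwc : LocallyIntegrableOn wc (Set.Ici 0)) (k : ℕ) :
    IntervalIntegrable (fun τ => wc (impulseTime T k + τ)) volume 0 (T k) := by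
  have h : IntervalIntegrable wc volume (impulseTime T k) (impulseTime T (k + 1)) := by
    rw [intervalIntegrable_iff_integrableOn_Icc_of_le (hT.strictMono.monotone (Nat.le_succ k))]
    exact hwc.integrableOn_compact_subset
      (fun t ht => (hT.impulseTime_nonneg k).trans ht.1) isCompact_Icc
  have := h.comp_add_left (impulseTime T k)
  rwa [sub_self, impulseTime_succ, add_sub_cancel_left] at this

/-- As `T k ≤ hc`, the delayed argument stays in `[-hc, t_k]`: the forcing on the next interval
involves only what is already constructed. -/
theorem intervalIntegrable_forcing {hc : ℝ} {T : ℕ → ℝ} (hT : IsDwellSequence T)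
    (hTc : ∀ k, T k ≤ hc) {wc : ℝ → Fin pc → ℝ} (hwc : LocallyIntegrableOn wc (Set.Ici 0))
    {x : ℝ → Fin n → ℝ} {k : ℕ} (hx : IntegrableOn x (Set.Icc (-hc) (impulseTime T k))) :
    IntervalIntegrable (S.forcing hc T wc x k) volume 0 (T k) := by
  have hk := hT.1 k
  refine IntervalIntegrable.add (IntervalIntegrable.mulVec hk.le (S.continuousOn_Gc_Icc _) ?_)
    (IntervalIntegrable.mulVec hk.le (S.continuousOn_Ec_Icc _)
      (intervalIntegrable_input_shift hT hwc k))
  have h : IntervalIntegrable x volume (impulseTime T k - hc) (impulseTime T k - hc + T k) := by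
    rw [intervalIntegrable_iff_integrableOn_Icc_of_le (by linarith)]
    exact hx.mono_set (Set.Icc_subset_Icc (by linarith [hT.impulseTime_nonneg k])
      (by linarith [hTc k]))
  have := h.comp_add_left (impulseTime T k - hc)
  rw [sub_self, add_sub_cancel_left] at this
  refine this.congr fun τ _ => ?_
  congr 1; ring

/-- Method of steps: if no dwell time exceeds the delay, solutions exist. -/
theorem exists_isSolution {hc : ℝ} (hd : ℕ) {T : ℕ → ℝ} (hT : IsDwellSequence T)
    (hTc : ∀ k, T k ≤ hc) {φ : ℝ → Fin n → ℝ} (ψ : ℕ → Fin n → ℝ) {wc : ℝ → Fin pc → ℝ}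
    (wd : ℕ → Fin pd → ℝ) (hφ : ContinuousOn φ (Set.Icc (-hc) 0))
    (hwc : LocallyIntegrableOn wc (Set.Ici 0)) :
    ∃ x, S.IsSolution hc hd T φ ψ wc wd x := by
  have hmono := hT.strictMono.monotone
  -- The integrability premise sits inside the existential so that `choose` gives a `Y` defined for
  -- every `X`.
  have hstep : ∀ (k : ℕ) (X : ℝ → Fin n → ℝ), ∃ y : ℝ → Fin n → ℝ,
      IntegrableOn X (Set.Icc (-hc) (impulseTime T k)) →
      IsFlow S.A (T k) (S.postJump hd T ψ wd X k) (S.forcing hc T wc X k) y := by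
    intro k X
    by_cases h : IntegrableOn X (Set.Icc (-hc) (impulseTime T k))
    · obtain ⟨y, hy⟩ := exists_isFlow (hT.1 k).le (S.continuousOn_A_Icc _)
        (S.postJump hd T ψ wd X k) (S.intervalIntegrable_forcing hT hTc hwc h)
      exact ⟨y, fun _ => hy⟩
    · exact ⟨0, fun h' => absurd h' h⟩
  choose Y hY using hstep
  -- Stage `k` is the solution up to `t_k` only; its later values are irrelevant and are overwritten
  -- by the next stage.
  let X : ℕ → ℝ → Fin n → ℝ := fun k => Nat.rec φ
    (fun k X t => if t ≤ impulseTime T k then X t else Y k X (t - impulseTime T k)) k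
  have hXsucc : ∀ k t, X (k + 1) t
      = if t ≤ impulseTime T k then X k t else Y k (X k) (t - impulseTime T k) := fun k t => rfl
  have hXint : ∀ k, IntegrableOn (X k) (Set.Icc (-hc) (impulseTime T k)) := by
    intro k
    induction k with
    | zero => rw [impulseTime_zero]; exact hφ.integrableOn_Icc
    | succ k ih =>
      have h1 : IntegrableOn (X (k + 1)) (Set.Icc (-hc) (impulseTime T k)) :=
        ih.congr_fun (fun t ht => by rw [hXsucc, if_pos ht.2]) measurableSet_Icc
      have h2 : IntegrableOn (X (k + 1)) (Set.Ioc (impulseTime T k) (impulseTime T (k + 1))) := by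
        have h3 : ContinuousOn (fun t => Y k (X k) (t - impulseTime T k))
            (Set.Icc (impulseTime T k) (impulseTime T (k + 1))) := by
          refine (hY k _ ih).cont.comp (Continuous.continuousOn (by fun_prop)) fun t ht => ?_
          rw [impulseTime_succ] at ht
          exact ⟨by linarith [ht.1], by linarith [ht.2]⟩
        refine (h3.integrableOn_Icc.mono_set Set.Ioc_subset_Icc_self).congr_fun (fun t ht => ?_)
          measurableSet_Ioc
        rw [hXsucc, if_neg (not_le.2 ht.1)]
      refine (h1.union h2).mono_set fun t ht => ?_
      rcases le_or_gt t (impulseTime T k) with h | h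
      · exact Or.inl ⟨ht.1, h⟩
      · exact Or.inr ⟨h, ht.2⟩
  have hXle : ∀ k m, k ≤ m → ∀ t, t ≤ impulseTime T k → X m t = X k t := by
    intro k m hkm
    induction m, hkm using Nat.le_induction with
    | base => intro t _; rfl
    | succ m hkm ih =>
      intro t ht
      rw [hXsucc, if_pos (ht.trans (hmono hkm)), ih t ht]
  have hex : ∀ t, ∃ k, t ≤ impulseTime T k := fun t => (hT.2.eventually_ge_atTop t).exists
  choose κ hκ using hex
  let x : ℝ → Fin n → ℝ := fun t => X (κ t) t
  have hx : ∀ k t, t ≤ impulseTime T k → x t = X k t := by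
    intro k t ht
    rcases le_total k (κ t) with h | h
    · exact hXle _ _ h t ht
    · exact (hXle _ _ h t (hκ t)).symm
  have hpost : ∀ k, S.postJump hd T ψ wd x k = S.postJump hd T ψ wd (X k) k := by
    intro k
    have h1 := hx k _ le_rfl
    have h2 : sampledDelay hd T ψ x k = sampledDelay hd T ψ (X k) k := by
      unfold sampledDelay
      split_ifs
      · exact hx k _ (hmono (Nat.sub_le _ _))
      · rfl
    unfold postJump
    split_ifs with h
    · exact hx k _ (hT.impulseTime_nonneg k)
    · rw [h1, h2]
  have hYx : ∀ k, ∀ τ ∈ Set.Ioc 0 (T k), x (impulseTime T k + τ) = Y k (X k) τ := by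
    intro k τ hτ
    rw [hx (k + 1) _ (by rw [impulseTime_succ]; linarith [hτ.2]), hXsucc,
      if_neg (by linarith [hτ.1]), add_sub_cancel_left]
  have hff : ∀ k, ∀ τ ∈ Set.Ioc 0 (T k), S.flowField hc T wc x k τ
      = S.A τ *ᵥ Y k (X k) τ + S.forcing hc T wc (X k) k τ := by
    intro k τ hτ
    rw [flowField_eq, hYx k τ hτ]
    unfold forcing
    rw [hx k (impulseTime T k + τ - hc) (by linarith [hτ.2, hTc k])]
  refine ⟨x, fun s hs => hx 0 s (by rw [impulseTime_zero]; exact hs.2), fun k => ?_,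
    fun k τ hτ => ?_⟩
  · have h := ((S.continuousOn_A_Icc _).mulVec
      (hY k _ (hXint k)).cont).intervalIntegrable_zero (hT.1 k).le
    refine (h.add (S.intervalIntegrable_forcing hT hTc hwc (hXint k))).congr fun τ hτ => ?_
    rw [Set.uIoc_of_le (hT.1 k).le] at hτ
    exact (hff k τ hτ).symm
  · rw [hYx k τ hτ, (hY k _ (hXint k)).eq τ ⟨hτ.1.le, hτ.2⟩, hpost]
    congr 1
    refine intervalIntegral.integral_congr_ae (Eventually.of_forall fun s hs => ?_)
    rw [Set.uIoc_of_le hτ.1.le] at hs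
    exact (hff k s ⟨hs.1, hs.2.trans hτ.2⟩).symm

theorem sampledDelay_add (hd : ℕ) (T : ℕ → ℝ) (ψ ψ' : ℕ → Fin n → ℝ) (x x' : ℝ → Fin n → ℝ)
    (k : ℕ) : sampledDelay hd T (ψ + ψ') (x + x') k
      = sampledDelay hd T ψ x k + sampledDelay hd T ψ' x' k := by
  unfold sampledDelay; split_ifs <;> rfl

theorem sampledDelay_neg (hd : ℕ) (T : ℕ → ℝ) (ψ : ℕ → Fin n → ℝ) (x : ℝ → Fin n → ℝ)
    (k : ℕ) : sampledDelay hd T (-ψ) (-x) k = -sampledDelay hd T ψ x k := by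
  unfold sampledDelay; split_ifs <;> rfl

theorem outputC_add (hc : ℝ) (wc wc' : ℝ → Fin pc → ℝ) (x x' : ℝ → Fin n → ℝ) (t : ℝ) :
    S.outputC hc (wc + wc') (x + x') t = S.outputC hc wc x t + S.outputC hc wc' x' t := by
  simp only [outputC, Pi.add_apply, mulVec_add]; abel

theorem outputC_neg (hc : ℝ) (wc : ℝ → Fin pc → ℝ) (x : ℝ → Fin n → ℝ) (t : ℝ) :
    S.outputC hc (-wc) (-x) t = -S.outputC hc wc x t := by
  simp only [outputC, Pi.neg_apply, mulVec_neg]; abel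

theorem outputD_add (hd : ℕ) (T : ℕ → ℝ) (ψ ψ' : ℕ → Fin n → ℝ) (wd wd' : ℕ → Fin pd → ℝ)
    (x x' : ℝ → Fin n → ℝ) (k : ℕ) : S.outputD hd T (ψ + ψ') (wd + wd') (x + x') k
      = S.outputD hd T ψ wd x k + S.outputD hd T ψ' wd' x' k := by
  simp only [outputD, sampledDelay_add, Pi.add_apply, mulVec_add]; abel

theorem outputD_neg (hd : ℕ) (T : ℕ → ℝ) (ψ : ℕ → Fin n → ℝ) (wd : ℕ → Fin pd → ℝ)
    (x : ℝ → Fin n → ℝ) (k : ℕ) :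
    S.outputD hd T (-ψ) (-wd) (-x) k = -S.outputD hd T ψ wd x k := by
  simp only [outputD, sampledDelay_neg, Pi.neg_apply, mulVec_neg]; abel

theorem flowField_add (hc : ℝ) (T : ℕ → ℝ) (wc wc' : ℝ → Fin pc → ℝ) (x x' : ℝ → Fin n → ℝ)
    (k : ℕ) : S.flowField hc T (wc + wc') (x + x') k
      = S.flowField hc T wc x k + S.flowField hc T wc' x' k := by
  ext1 τ
  simp only [flowField, Pi.add_apply, mulVec_add]; abel

theorem flowField_neg (hc : ℝ) (T : ℕ → ℝ) (wc : ℝ → Fin pc → ℝ) (x : ℝ → Fin n → ℝ)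
    (k : ℕ) : S.flowField hc T (-wc) (-x) k = -S.flowField hc T wc x k := by
  ext1 τ
  simp only [flowField, Pi.neg_apply, mulVec_neg]; abel

theorem postJump_add (hd : ℕ) (T : ℕ → ℝ) (ψ ψ' : ℕ → Fin n → ℝ) (wd wd' : ℕ → Fin pd → ℝ)
    (x x' : ℝ → Fin n → ℝ) (k : ℕ) : S.postJump hd T (ψ + ψ') (wd + wd') (x + x') k
      = S.postJump hd T ψ wd x k + S.postJump hd T ψ' wd' x' k := by
  unfold postJump
  split_ifs
  · rfl
  · simp only [sampledDelay_add, Pi.add_apply, mulVec_add]; abel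

theorem postJump_neg (hd : ℕ) (T : ℕ → ℝ) (ψ : ℕ → Fin n → ℝ) (wd : ℕ → Fin pd → ℝ)
    (x : ℝ → Fin n → ℝ) (k : ℕ) :
    S.postJump hd T (-ψ) (-wd) (-x) k = -S.postJump hd T ψ wd x k := by
  unfold postJump
  split_ifs
  · rfl
  · simp only [sampledDelay_neg, Pi.neg_apply, mulVec_neg]; abel

variable {S}

theorem IsSolution.add {hc : ℝ} {hd : ℕ} {T : ℕ → ℝ} {φ φ' : ℝ → Fin n → ℝ}
    {ψ ψ' : ℕ → Fin n → ℝ} {wc wc' : ℝ → Fin pc → ℝ} {wd wd' : ℕ → Fin pd → ℝ}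
    {x x' : ℝ → Fin n → ℝ} (h : S.IsSolution hc hd T φ ψ wc wd x)
    (h' : S.IsSolution hc hd T φ' ψ' wc' wd' x') :
    S.IsSolution hc hd T (φ + φ') (ψ + ψ') (wc + wc') (wd + wd') (x + x') := by
  refine ⟨fun s hs => ?_, fun k => ?_, fun k τ hτ => ?_⟩
  · simp only [Pi.add_apply, h.initial s hs, h'.initial s hs]
  · rw [flowField_add]; exact (h.integrable k).add (h'.integrable k)
  · have hm : τ ∈ Set.Icc 0 (T k) := ⟨hτ.1.le, hτ.2⟩
    rw [Pi.add_apply, h.flow k τ hτ, h'.flow k τ hτ, postJump_add, flowField_add,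
      add_add_add_comm, ← intervalIntegral.integral_add
        (intervalIntegrable_left_of_mem (h.integrable k) hm)
        (intervalIntegrable_left_of_mem (h'.integrable k) hm)]
    rfl

theorem IsSolution.neg {hc : ℝ} {hd : ℕ} {T : ℕ → ℝ} {φ : ℝ → Fin n → ℝ}
    {ψ : ℕ → Fin n → ℝ} {wc : ℝ → Fin pc → ℝ} {wd : ℕ → Fin pd → ℝ}
    {x : ℝ → Fin n → ℝ} (h : S.IsSolution hc hd T φ ψ wc wd x) :
    S.IsSolution hc hd T (-φ) (-ψ) (-wc) (-wd) (-x) := by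
  refine ⟨fun s hs => ?_, fun k => ?_, fun k τ hτ => ?_⟩
  · simp only [Pi.neg_apply, h.initial s hs]
  · rw [flowField_neg]; exact (h.integrable k).neg
  · rw [Pi.neg_apply, h.flow k τ hτ, postJump_neg, flowField_neg, neg_add,
      ← intervalIntegral.integral_neg]
    rfl

/-- The continuous extension of `τ ↦ x (t_k + τ)` from `(0, T_k]` to `[0, T_k]`. -/
noncomputable def pieceExt (S : ImpulsiveDelaySystem n pc pd qc qd) (hc : ℝ) (hd : ℕ) (T : ℕ → ℝ)
    (ψ : ℕ → Fin n → ℝ) (wc : ℝ → Fin pc → ℝ) (wd : ℕ → Fin pd → ℝ) (x : ℝ → Fin n → ℝ) (k : ℕ)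
    (τ : ℝ) : Fin n → ℝ :=
  S.postJump hd T ψ wd x k + ∫ s in (0 : ℝ)..τ, S.flowField hc T wc x k s

section Piece

variable {hc : ℝ} {hd : ℕ} {T : ℕ → ℝ} {φ : ℝ → Fin n → ℝ}
    {ψ : ℕ → Fin n → ℝ} {wc : ℝ → Fin pc → ℝ} {wd : ℕ → Fin pd → ℝ} {x : ℝ → Fin n → ℝ}

theorem IsSolution.eq_pieceExt (h : S.IsSolution hc hd T φ ψ wc wd x) {k : ℕ} {τ : ℝ}
    (hτ : τ ∈ Set.Ioc 0 (T k)) :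
    x (impulseTime T k + τ) = S.pieceExt hc hd T ψ wc wd x k τ := h.flow k τ hτ

theorem pieceExt_zero (k : ℕ) :
    S.pieceExt hc hd T ψ wc wd x k 0 = S.postJump hd T ψ wd x k := by simp [pieceExt]

theorem IsSolution.continuousOn_pieceExt (hT : IsDwellSequence T)
    (h : S.IsSolution hc hd T φ ψ wc wd x) (k : ℕ) :
    ContinuousOn (S.pieceExt hc hd T ψ wc wd x k) (Set.Icc 0 (T k)) := by
  have := intervalIntegral.continuousOn_primitive_interval' (μ := volume) (h.integrable k)
    Set.left_mem_uIcc
  rw [Set.uIcc_of_le (hT.1 k).le] at this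
  exact continuousOn_const.add this

/-- A solution comes with integrability of the whole flow field only. Subtracting `A` times the
continuous extension of the piece isolates the forcing. -/
theorem IsSolution.intervalIntegrable_forcing (hT : IsDwellSequence T)
    (h : S.IsSolution hc hd T φ ψ wc wd x) (k : ℕ) :
    IntervalIntegrable (S.forcing hc T wc x k) volume 0 (T k) := by
  have h1 := ((S.continuousOn_A_Icc (T k)).mulVec
    (h.continuousOn_pieceExt hT k)).intervalIntegrable_zero (hT.1 k).le
  refine ((h.integrable k).sub h1).congr fun τ hτ => ?_
  rw [Set.uIoc_of_le (hT.1 k).le] at hτ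
  rw [flowField_eq, h.eq_pieceExt hτ, add_sub_cancel_left]

theorem IsSolution.isFlow_pieceExt (hT : IsDwellSequence T)
    (h : S.IsSolution hc hd T φ ψ wc wd x) (k : ℕ) :
    IsFlow S.A (T k) (S.postJump hd T ψ wd x k) (S.forcing hc T wc x k)
      (S.pieceExt hc hd T ψ wc wd x k) := by
  refine ⟨h.continuousOn_pieceExt hT k, fun t ht => ?_⟩
  conv_lhs => unfold pieceExt
  congr 1
  refine intervalIntegral.integral_congr_ae (Eventually.of_forall fun s hs => ?_)
  rw [Set.uIoc_of_le ht.1] at hs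
  rw [flowField_eq, h.eq_pieceExt ⟨hs.1, hs.2.trans ht.2⟩]

/-- Nonnegativity passes to the closure of the open interval. At `τ = 0` this yields the sign of the
post-jump state, which is not itself a value of `x` at an impulse time. -/
theorem IsSolution.pieceExt_nonneg (hT : IsDwellSequence T)
    (h : S.IsSolution hc hd T φ ψ wc wd x) (hx : ∀ t, 0 ≤ t → 0 ≤ x t) (k : ℕ) :
    ∀ τ ∈ Set.Icc 0 (T k), 0 ≤ S.pieceExt hc hd T ψ wc wd x k τ := by
  have hk := hT.1 k
  have hcl : ∀ τ ∈ closure (Set.Ioo 0 (T k)), 0 ≤ S.pieceExt hc hd T ψ wc wd x k τ := by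
    intro τ hτ
    have hcont := h.continuousOn_pieceExt hT k
    rw [← closure_Ioo hk.ne] at hcont
    have := hcont.image_closure
    have h2 : S.pieceExt hc hd T ψ wc wd x k τ ∈
        closure (S.pieceExt hc hd T ψ wc wd x k '' Set.Ioo 0 (T k)) := this ⟨τ, hτ, rfl⟩
    have h3 : closure (S.pieceExt hc hd T ψ wc wd x k '' Set.Ioo 0 (T k)) ⊆ Set.Ici 0 := by
      refine closure_minimal ?_ isClosed_Ici
      rintro _ ⟨σ, hσ, rfl⟩
      rw [← h.eq_pieceExt ⟨hσ.1, hσ.2.le⟩]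
      exact hx _ (by linarith [hT.impulseTime_nonneg k, hσ.1])
    exact h3 h2
  rwa [closure_Ioo hk.ne] at hcl

end Piece

end ImpulsiveDelaySystem

theorem IsFlow.restrict {n : ℕ} {A : ℝ → Matrix (Fin n) (Fin n) ℝ} {L L' : ℝ} (hL : L' ≤ L)
    {x0 : Fin n → ℝ} {f y : ℝ → Fin n → ℝ} (hy : IsFlow A L x0 f y) : IsFlow A L' x0 f y :=
  ⟨hy.cont.mono (Set.Icc_subset_Icc_right hL), fun t ht => hy.eq t ⟨ht.1, ht.2.trans hL⟩⟩

theorem IsFlow.congr_forcing {n : ℕ} {A : ℝ → Matrix (Fin n) (Fin n) ℝ} {L : ℝ}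
    {x0 : Fin n → ℝ} {f g y : ℝ → Fin n → ℝ} (hy : IsFlow A L x0 f y)
    (hfg : ∀ s ∈ Set.Ioc 0 L, f s = g s) : IsFlow A L x0 g y := by
  refine ⟨hy.cont, fun t ht => ?_⟩
  rw [hy.eq t ht]
  congr 1
  refine intervalIntegral.integral_congr_ae (Eventually.of_forall fun s hs => ?_)
  rw [Set.uIoc_of_le ht.1] at hs
  rw [hfg s ⟨hs.1, hs.2.trans ht.2⟩]

theorem IsFlow.apply_zero {n : ℕ} {A : ℝ → Matrix (Fin n) (Fin n) ℝ} {L : ℝ} (hL : 0 ≤ L)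
    {x0 : Fin n → ℝ} {f y : ℝ → Fin n → ℝ} (hy : IsFlow A L x0 f y) : y 0 = x0 := by
  rw [hy.eq 0 ⟨le_rfl, hL⟩]; simp

theorem isDwellSequence_const {L : ℝ} (hL : 0 < L) : IsDwellSequence fun _ => L := by
  refine ⟨fun _ => hL, ?_⟩
  have : impulseTime (fun _ => L) = fun k : ℕ => (k : ℝ) * L := by
    ext k; simp [impulseTime]
  rw [this]
  exact tendsto_natCast_atTop_atTop.atTop_mul_const hL

/-! ### What internal positivity says about single flows and about the matrices. -/

namespace ImpulsiveDelaySystem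

variable {n pc pd qc qd : ℕ} {S : ImpulsiveDelaySystem n pc pd qc qd}

/-- Any flow of `y' = A y + Gc u` is the first piece of a solution without inputs, for a suitable
initial function and arbitrary initial samples. -/
theorem exists_isSolution_extending {L : ℝ} (hL : 0 < L) {x0 : Fin n → ℝ} {u y : ℝ → Fin n → ℝ}
    (hu : ContinuousOn u (Set.Icc 0 L)) (hx0 : 0 ≤ x0) (hu0 : ∀ s ∈ Set.Icc 0 L, 0 ≤ u s)
    (hy : IsFlow S.A L x0 (fun s => S.Gc s *ᵥ u s) y) (hd : ℕ) (ψ : ℕ → Fin n → ℝ) :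
    ∃ φ x, ContinuousOn φ (Set.Icc (-(2 * L)) 0) ∧ (∀ s ∈ Set.Icc (-(2 * L)) 0, 0 ≤ φ s) ∧
      S.IsSolution (2 * L) hd (fun _ => L) φ ψ 0 0 x ∧
      ∀ τ ∈ Set.Ioc 0 L, x τ = y τ ∧ x (τ - 2 * L) = u τ := by
  -- The delay `2 L` leaves `[-L, 0]` free: the initial function is the shifted `u` on `[-2L, -L]`
  -- and is interpolated to `x0` at `0`, so `u` and `x0` can be prescribed independently.
  set c : ℝ → ℝ := fun s => min 1 (-s / L) with hcdef
  set φ : ℝ → Fin n → ℝ := fun s => c s • u (min (s + 2 * L) L) + (1 - c s) • x0 with hφdef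
  have hmem : ∀ s ∈ Set.Icc (-(2 * L)) 0, min (s + 2 * L) L ∈ Set.Icc 0 L := fun s hs =>
    ⟨le_min (by linarith [hs.1]) hL.le, min_le_right _ _⟩
  have hφc : ContinuousOn φ (Set.Icc (-(2 * L)) 0) := by
    have h1 : ContinuousOn c (Set.Icc (-(2 * L)) 0) := Continuous.continuousOn (by fun_prop)
    exact (h1.smul (hu.comp (Continuous.continuousOn (by fun_prop)) hmem)).add
      ((continuousOn_const.sub h1).smul continuousOn_const)
  have hφ0 : ∀ s ∈ Set.Icc (-(2 * L)) 0, 0 ≤ φ s := fun s hs => by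
    have h1 : 0 ≤ c s := le_min zero_le_one (div_nonneg (by linarith [hs.2]) hL.le)
    have h2 : 0 ≤ 1 - c s := sub_nonneg.2 (min_le_left _ _)
    exact add_nonneg (smul_nonneg h1 (hu0 _ (hmem s hs))) (smul_nonneg h2 hx0)
  have hφu : ∀ τ ∈ Set.Ioc 0 L, φ (τ - 2 * L) = u τ := fun τ hτ => by
    have h1 : c (τ - 2 * L) = 1 := by
      refine min_eq_left ?_
      rw [le_div_iff₀ hL]; linarith [hτ.2]
    simp [hφdef, h1, hτ.2]
  have hT := isDwellSequence_const hL
  obtain ⟨x, hx⟩ := S.exists_isSolution (hc := 2 * L) hd hT (fun _ => by linarith) ψ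
    (wc := 0) 0 hφc ((locallyIntegrable_zero).locallyIntegrableOn _)
  have hxφ : ∀ τ ∈ Set.Ioc 0 L, x (τ - 2 * L) = u τ := fun τ hτ => by
    rw [hx.initial _ ⟨by linarith [hτ.1], by linarith [hτ.2]⟩, hφu τ hτ]
  refine ⟨φ, x, hφc, hφ0, hx, fun τ hτ => ⟨?_, hxφ τ hτ⟩⟩
  have hfl := hx.isFlow_pieceExt hT 0
  have hpost : S.postJump hd (fun _ => L) ψ 0 x 0 = x0 := by
    have : x 0 = x0 := by
      rw [hx.initial 0 ⟨by linarith, le_rfl⟩]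
      simp [hφdef, hcdef]
    simp [postJump, this]
  rw [hpost] at hfl
  have hfl' := hfl.congr_forcing (g := fun s => S.Gc s *ᵥ u s) fun s hs => by
    simp [forcing, impulseTime_zero, hxφ s hs]
  have h1 := hx.eq_pieceExt (k := 0) hτ
  rw [impulseTime_zero, zero_add] at h1
  rw [h1]
  exact hfl'.eqOn (S.continuousOn_A_Icc L)
    (((S.continuousOn_Gc_Icc L).mulVec hu).intervalIntegrable_zero hL.le) hy ⟨hτ.1.le, hτ.2⟩

/-- Consequences of internal positivity for a single flow `y' = A y + Gc u`. -/
theorem InternallyPositive.flow_nonneg (hpos : S.InternallyPositive) {L : ℝ} (hL : 0 < L)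
    {x0 : Fin n → ℝ} {u y : ℝ → Fin n → ℝ}
    (hu : ContinuousOn u (Set.Icc 0 L)) (hx0 : 0 ≤ x0) (hu0 : ∀ s ∈ Set.Icc 0 L, 0 ≤ u s)
    (hy : IsFlow S.A L x0 (fun s => S.Gc s *ᵥ u s) y) {v : Fin n → ℝ} (hv : 0 ≤ v) :
    (∀ τ ∈ Set.Icc 0 L, 0 ≤ y τ) ∧ (∀ τ ∈ Set.Ioc 0 L, 0 ≤ S.Cc *ᵥ y τ + S.Hc *ᵥ u τ) ∧
      0 ≤ S.J *ᵥ y L + S.Gd *ᵥ v ∧ 0 ≤ S.Cd *ᵥ y L + S.Hd *ᵥ v := by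
  -- With discrete delay `2`, the first jump reads `ψ 1`, which makes `v` independent of the flow.
  obtain ⟨φ, x, hφc, hφ0, hx, hxy⟩ := exists_isSolution_extending hL hu hx0 hu0 hy 2 fun _ => v
  have hT := isDwellSequence_const hL
  obtain ⟨h1, h2, h3⟩ := hpos (2 * L) 2 _ (by linarith) hT φ (fun _ => v) 0 0 x hφc
    ((locallyIntegrable_zero).locallyIntegrableOn _) hφ0 (fun _ => hv) (fun _ _ => le_rfl)
    (fun _ => le_rfl) hx
  have hL1 : impulseTime (fun _ => L) 1 = L := by simp [impulseTime]
  have hxL := (hxy L ⟨hL, le_rfl⟩).1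
  refine ⟨fun τ hτ => ?_, fun τ hτ => ?_, ?_, ?_⟩
  · rcases hτ.1.eq_or_lt with h | h
    · rw [← h, hy.apply_zero hL.le]; exact hx0
    · rw [← (hxy τ ⟨h, hτ.2⟩).1]; exact h1 τ hτ.1
  · have := h2 τ hτ.1
    simpa [outputC, hxy τ hτ] using this
  · have := hx.pieceExt_nonneg hT h1 1 0 ⟨le_rfl, hL.le⟩
    rw [pieceExt_zero] at this
    simpa [postJump, sampledDelay, hL1, hxL] using this
  · have := h3 1 le_rfl
    simpa [outputD, sampledDelay, hL1, hxL] using this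

theorem isFlow_zero {A : ℝ → Matrix (Fin n) (Fin n) ℝ} {L : ℝ} {f : ℝ → Fin n → ℝ}
    (hf : ∀ s, f s = 0) : IsFlow A L 0 f 0 :=
  ⟨continuousOn_const, fun t _ => by simp [hf]⟩

/-- The zero flow leaves only the delayed sample in the jump. -/
theorem InternallyPositive.Gd_nonneg (hpos : S.InternallyPositive) {v : Fin n → ℝ} (hv : 0 ≤ v) :
    0 ≤ S.Gd *ᵥ v := by
  have := (hpos.flow_nonneg zero_lt_one (x0 := 0) (u := 0) continuousOn_const le_rfl
    (fun _ _ => le_rfl) (isFlow_zero fun _ => by simp) hv).2.2.1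
  simpa using this

theorem InternallyPositive.Hd_nonneg (hpos : S.InternallyPositive) {v : Fin n → ℝ} (hv : 0 ≤ v) :
    0 ≤ S.Hd *ᵥ v := by
  have := (hpos.flow_nonneg zero_lt_one (x0 := 0) (u := 0) continuousOn_const le_rfl
    (fun _ _ => le_rfl) (isFlow_zero fun _ => by simp) hv).2.2.2
  simpa using this

/-- The values near time `0` of a flow with initial value `v` and constant delayed term `w`. -/
theorem InternallyPositive.exists_flow_tendsto (hpos : S.InternallyPositive) {v w : Fin n → ℝ}
    (hv : 0 ≤ v) (hw : 0 ≤ w) : ∃ y : ℝ → Fin n → ℝ, Tendsto y (𝓝[>] 0) (𝓝 v) ∧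
      ∀ᶠ τ in 𝓝[>] (0 : ℝ), 0 ≤ S.Cc *ᵥ y τ + S.Hc *ᵥ w ∧ 0 ≤ S.J *ᵥ y τ ∧ 0 ≤ S.Cd *ᵥ y τ := by
  have hint := ((S.continuousOn_Gc_Icc 1).mulVec
    (continuousOn_const (c := w))).intervalIntegrable_zero zero_le_one
  obtain ⟨y, hy⟩ := exists_isFlow zero_le_one (S.continuousOn_A_Icc 1) v hint
  refine ⟨y, ?_, ?_⟩
  · have h1 := hy.cont 0 ⟨le_rfl, zero_le_one⟩
    rw [ContinuousWithinAt, hy.apply_zero zero_le_one] at h1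
    refine h1.mono_left ?_
    rw [← nhdsWithin_Ioc_eq_nhdsGT (zero_lt_one' ℝ)]
    exact nhdsWithin_mono _ Set.Ioc_subset_Icc_self
  · filter_upwards [Ioc_mem_nhdsGT (zero_lt_one' ℝ)] with τ hτ
    -- Restricted to `[0, τ]` the flow ends at `τ`, so the signs known at the end of a flow hold at
    -- every small `τ`.
    obtain ⟨-, h2, h3, h4⟩ := hpos.flow_nonneg hτ.1 (u := fun _ => w) continuousOn_const hv
      (fun _ _ => hw) (hy.restrict hτ.2) (le_refl 0)
    exact ⟨h2 τ ⟨hτ.1, le_rfl⟩, by simpa using h3, by simpa using h4⟩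

/-- Pointwise signs arise as limits at time `0` along a flow started at `v`, since only states
reached by flows are covered by the definition. -/
theorem InternallyPositive.outputC_nonneg (hpos : S.InternallyPositive) {v w : Fin n → ℝ}
    (hv : 0 ≤ v) (hw : 0 ≤ w) : 0 ≤ S.Cc *ᵥ v + S.Hc *ᵥ w := by
  obtain ⟨y, hy, h⟩ := hpos.exists_flow_tendsto hv hw
  refine ge_of_tendsto (f := fun τ => S.Cc *ᵥ y τ + S.Hc *ᵥ w) ?_ (h.mono fun _ h => h.1)
  exact (((Continuous.matrix_mulVec continuous_const continuous_id).tendsto v).comp hy).add_const _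

theorem InternallyPositive.J_nonneg (hpos : S.InternallyPositive) {v : Fin n → ℝ}
    (hv : 0 ≤ v) : 0 ≤ S.J *ᵥ v := by
  obtain ⟨y, hy, h⟩ := hpos.exists_flow_tendsto hv le_rfl
  refine ge_of_tendsto (f := fun τ => S.J *ᵥ y τ) ?_ (h.mono fun _ h => h.2.1)
  exact ((Continuous.matrix_mulVec continuous_const continuous_id).tendsto v).comp hy

theorem InternallyPositive.Cd_nonneg (hpos : S.InternallyPositive) {v : Fin n → ℝ}
    (hv : 0 ≤ v) : 0 ≤ S.Cd *ᵥ v := by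
  obtain ⟨y, hy, h⟩ := hpos.exists_flow_tendsto hv le_rfl
  refine ge_of_tendsto (f := fun τ => S.Cd *ᵥ y τ) ?_ (h.mono fun _ h => h.2.2)
  exact ((Continuous.matrix_mulVec continuous_const continuous_id).tendsto v).comp hy

theorem norm_le_norm_of_nonneg_of_le {v w : Fin n → ℝ} (hv : 0 ≤ v) (hvw : v ≤ w) :
    ‖v‖ ≤ ‖w‖ := by
  rw [pi_norm_le_iff_of_nonneg (norm_nonneg _)]
  intro i
  rw [Real.norm_of_nonneg (hv i)]
  exact (hvw i).trans ((le_abs_self _).trans (norm_le_pi_norm w i))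

/-- A nonnegative flow is controlled by its final value. -/
theorem InternallyPositive.norm_le_final (hpos : S.InternallyPositive) {L K : ℝ} (hL : 0 < L)
    (hK : 0 ≤ K) (hAK : ∀ t ∈ Set.Icc 0 L, ∀ v, ‖S.A t *ᵥ v‖ ≤ K * ‖v‖)
    {x0 : Fin n → ℝ} {u y : ℝ → Fin n → ℝ}
    (hu : ContinuousOn u (Set.Icc 0 L)) (hx0 : 0 ≤ x0) (hu0 : ∀ s ∈ Set.Icc 0 L, 0 ≤ u s)
    (hy : IsFlow S.A L x0 (fun s => S.Gc s *ᵥ u s) y) :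
    ∀ s ∈ Set.Icc 0 L, ‖y s‖ ≤ Real.exp (K * L) * ‖y L‖ := by
  intro s hs
  have hLL : L ∈ Set.Icc 0 L := ⟨hL.le, le_rfl⟩
  have hA := S.continuousOn_A_Icc L
  have hGu := (S.continuousOn_Gc_Icc L).mulVec hu
  obtain ⟨M, hM⟩ := isCompact_Icc.exists_bound_of_continuousOn hGu
  have hM0 : 0 ≤ M := (norm_nonneg _).trans (hM 0 ⟨le_rfl, hL.le⟩)
  -- A backward estimate alone would involve the forcing on `[s, L]`. That part of the forcing is
  -- split off: its response `d` vanishes up to `s` and is nonnegative at `L`, so removing it keeps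
  -- `y s` and lowers the final value.
  have key : ∀ δ > 0, ‖y s‖ ≤ (‖y L‖ + M * δ) * Real.exp (K * L) := by
    intro δ hδ
    -- A continuous cut-off, equal to `1` up to `s` and decaying at scale `δ` afterwards; continuity
    -- keeps `flow_nonneg` applicable to both parts.
    set χ : ℝ → ℝ := fun r => Real.exp (-(max 0 (r - s)) / δ) with hχ
    have hχc : Continuous χ := by fun_prop
    have hχ1 : ∀ r, χ r ≤ 1 := fun r => by
      rw [hχ, Real.exp_le_one_iff]
      exact div_nonpos_of_nonpos_of_nonneg (neg_nonpos.2 (le_max_left _ _)) hδ.le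
    have hχ0 : ∀ r, 0 ≤ χ r := fun r => (Real.exp_pos _).le
    have hu1 : ContinuousOn (fun r => (1 - χ r) • u r) (Set.Icc 0 L) :=
      (continuous_const.sub hχc).continuousOn.smul hu
    have hu2 : ContinuousOn (fun r => χ r • u r) (Set.Icc 0 L) := hχc.continuousOn.smul hu
    have hi := hGu.intervalIntegrable_zero hL.le
    have hi1 := ((S.continuousOn_Gc_Icc L).mulVec hu1).intervalIntegrable_zero hL.le
    have hi2 := ((S.continuousOn_Gc_Icc L).mulVec hu2).intervalIntegrable_zero hL.le
    obtain ⟨d, hd⟩ := exists_isFlow hL.le hA 0 hi1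
    have he := (hy.sub hL.le hA hi hi1 hd).congr_forcing
      (g := fun r => S.Gc r *ᵥ (χ r • u r)) fun r _ => by
        simp only [Pi.sub_apply, ← mulVec_sub]
        congr 1
        module
    rw [sub_zero] at he
    have hdL := (hpos.flow_nonneg hL hu1 le_rfl
      (fun r hr => smul_nonneg (sub_nonneg.2 (hχ1 r)) (hu0 r hr)) hd (le_refl 0)).1 L hLL
    have heL := (hpos.flow_nonneg hL hu2 hx0
      (fun r hr => smul_nonneg (hχ0 r) (hu0 r hr)) he (le_refl 0)).1 L hLL
    have hds : d s = 0 := by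
      have h := hd.norm_le hK hA hAK hi1 s hs
      have h0 : ∫ r in (0 : ℝ)..s, ‖S.Gc r *ᵥ ((1 - χ r) • u r)‖ = 0 := by
        rw [intervalIntegral.integral_congr (g := fun _ => (0 : ℝ))]
        · simp
        · intro r hr
          rw [Set.uIcc_of_le hs.1] at hr
          have : χ r = 1 := by simp [hχ, max_eq_left (sub_nonpos.2 hr.2)]
          simp [this]
      rw [h0] at h
      simpa using h
    have hes : (y - d) s = y s := by simp [hds]
    have hb := he.norm_le_backward hK hA hAK hi2 s hs
    rw [hes] at hb
    -- Here positivity enters: `0 ≤ (y - d) L ≤ y L`.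
    have h1 : ‖(y - d) L‖ ≤ ‖y L‖ := norm_le_norm_of_nonneg_of_le heL (by simpa using hdL)
    have h2 : ∫ r in s..L, ‖S.Gc r *ᵥ (χ r • u r)‖ ≤ M * δ := by
      have hder : ∀ r ∈ Set.uIcc s L, HasDerivAt (fun r => -(M * δ) * Real.exp (-(r - s) / δ))
          (M * Real.exp (-(r - s) / δ)) r := by
        intro r _
        have h0 : HasDerivAt (fun r => -(r - s) / δ) (-1 / δ) r :=
          ((hasDerivAt_id r).sub_const s).neg.div_const δ
        convert! h0.exp.const_mul (-(M * δ)) using 1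
        field_simp
      have hI := intervalIntegral.integral_eq_sub_of_hasDerivAt hder
        (Continuous.intervalIntegrable (by fun_prop) _ _)
      calc ∫ r in s..L, ‖S.Gc r *ᵥ (χ r • u r)‖
          ≤ ∫ r in s..L, M * Real.exp (-(r - s) / δ) := by
            refine intervalIntegral.integral_mono_on hs.2
              (intervalIntegrable_right_of_mem hi2 hs).norm
              (Continuous.intervalIntegrable (by fun_prop) _ _) fun r hr => ?_
            rw [mulVec_smul, norm_smul, Real.norm_of_nonneg (hχ0 r), mul_comm]
            simp only [hχ, max_eq_right (sub_nonneg.2 hr.1)]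
            exact mul_le_mul_of_nonneg_right (hM r ⟨hs.1.trans hr.1, hr.2⟩) (Real.exp_pos _).le
        _ = M * δ - M * δ * Real.exp (-(L - s) / δ) := by rw [hI]; simp; ring
        _ ≤ M * δ := by
            have := Real.exp_pos (-(L - s) / δ)
            linarith [mul_nonneg (mul_nonneg hM0 hδ.le) this.le]
    refine hb.trans ?_
    gcongr
    linarith [hs.1]
  have hE := Real.exp_pos (K * L)
  refine le_of_forall_pos_le_add fun ε hε => ?_
  have h3 := key (ε / (M * Real.exp (K * L) + 1)) (by positivity)
  have h4 : M * (ε / (M * Real.exp (K * L) + 1)) * Real.exp (K * L) ≤ ε := by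
    rw [mul_div_assoc', div_mul_eq_mul_div, div_le_iff₀ (by positivity)]
    nlinarith
  nlinarith

end ImpulsiveDelaySystem

/-! ### A product rule inequality for weak regularity. -/

/-- Product rule inequality: `z` is right differentiable with `z' ≤ ρ`, and `y ≥ 0` is a primitive
of an integrable function. -/
theorem mul_sub_mul_le_integral {L : ℝ} (hL : 0 ≤ L) {z z' ρ y f : ℝ → ℝ} {y0 : ℝ}
    (hz : ContinuousOn z (Set.Icc 0 L))
    (hz' : ∀ s ∈ Set.Ioo 0 L, HasDerivWithinAt z (z' s) (Set.Ioi s) s)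
    (hρ : ContinuousOn ρ (Set.Icc 0 L)) (hz'ρ : ∀ s ∈ Set.Ioo 0 L, z' s ≤ ρ s)
    (hf : IntervalIntegrable f volume 0 L)
    (hy : ∀ t ∈ Set.Icc 0 L, y t = y0 + ∫ s in (0 : ℝ)..t, f s)
    (hy0 : ∀ t ∈ Set.Icc 0 L, 0 ≤ y t) :
    z L * y L - z 0 * y 0 ≤ ∫ s in (0 : ℝ)..L, (ρ s * y s + z s * f s) := by
  have hLm : L ∈ Set.Icc 0 L := ⟨hL, le_rfl⟩
  have h0m : (0 : ℝ) ∈ Set.Icc 0 L := ⟨le_rfl, hL⟩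
  obtain ⟨Bz, hBz⟩ := isCompact_Icc.exists_bound_of_continuousOn hz
  obtain ⟨Bρ, hBρ⟩ := isCompact_Icc.exists_bound_of_continuousOn hρ
  have hBz0 : 0 ≤ Bz := (norm_nonneg _).trans (hBz 0 h0m)
  have hBρ0 : 0 ≤ Bρ := (norm_nonneg _).trans (hBρ 0 h0m)
  have hyc : ContinuousOn y (Set.Icc 0 L) := by
    have := intervalIntegral.continuousOn_primitive_interval' (μ := volume) hf Set.left_mem_uIcc
    rw [Set.uIcc_of_le hL] at this
    exact (continuousOn_const.add this).congr hy
  have key : ∀ η > 0, z L * y L - z 0 * y 0 ≤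
      (∫ s in (0 : ℝ)..L, (ρ s * y s + z s * f s)) + η * (5 * Bz + 2 * Bρ * L) := by
    intro η hη
    have hfI : Integrable (Set.indicator (Set.Ioc 0 L) f) :=
      (integrable_indicator_iff measurableSet_Ioc).2
        ((intervalIntegrable_iff_integrableOn_Ioc_of_le hL).1 hf)
    -- The mean value inequality needs a derivative at every point, so `f` is replaced by a
    -- continuous function close in `L¹`.
    obtain ⟨g, -, hgf, hgc, hgI⟩ := hfI.exists_hasCompactSupport_integral_sub_le hη
    have hgi : ∀ a b, IntervalIntegrable g volume a b := fun a b => hgc.intervalIntegrable a b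
    have hfg : ∫ s in (0 : ℝ)..L, ‖g s - f s‖ ≤ η := by
      rw [intervalIntegral.integral_of_le hL]
      refine le_trans ?_ hgf
      calc _ = ∫ s in Set.Ioc 0 L, ‖(Set.Ioc 0 L).indicator f s - g s‖ := by
            refine setIntegral_congr_fun measurableSet_Ioc fun s hs => ?_
            rw [Set.indicator_of_mem hs, norm_sub_rev]
        _ ≤ _ := setIntegral_le_integral (hfI.sub hgI).norm
            (Eventually.of_forall fun s => norm_nonneg _)
    -- The shift by `η` compensates the approximation error and keeps `q` nonnegative, as required
    -- for multiplying `z' ≤ ρ` by `q`.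
    set q : ℝ → ℝ := fun t => y0 + η + ∫ s in (0 : ℝ)..t, g s with hq
    have hqy : ∀ t ∈ Set.Icc 0 L, |q t - y t - η| ≤ η := by
      intro t ht
      have : q t - y t - η = ∫ s in (0 : ℝ)..t, (g s - f s) := by
        rw [intervalIntegral.integral_sub (hgi _ _) (intervalIntegrable_left_of_mem hf ht), hy t ht]
        simp only [hq]; ring
      rw [this]
      refine (intervalIntegral.norm_integral_le_integral_norm (f := fun s => g s - f s)
        ht.1).trans (le_trans ?_ hfg)
      exact intervalIntegral.integral_mono_interval le_rfl ht.1 ht.2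
        (Eventually.of_forall fun s => norm_nonneg _) ((hgi _ _).sub hf).norm
    have hqder : ∀ s, HasDerivAt q (g s) s := fun s =>
      (intervalIntegral.integral_hasDerivAt_right (hgi _ _)
        (hgc.stronglyMeasurableAtFilter _ _) hgc.continuousAt).const_add _
    have hqc : Continuous q := continuous_iff_continuousAt.2 fun s => (hqder s).continuousAt
    have hq0 : ∀ t ∈ Set.Icc 0 L, 0 ≤ q t := fun t ht => by
      have := (abs_le.1 (hqy t ht)).1
      linarith [hy0 t ht]
    have hq2 : ∀ t ∈ Set.Icc 0 L, |q t - y t| ≤ 2 * η := fun t ht => by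
      have := abs_le.1 (hqy t ht)
      rw [abs_le]; constructor <;> linarith
    have hφc : ContinuousOn (fun s => ρ s * q s + z s * g s) (Set.Icc 0 L) :=
      (hρ.mul hqc.continuousOn).add (hz.mul hgc.continuousOn)
    have hmain : z L * q L - z 0 * q 0 ≤ ∫ s in (0 : ℝ)..L, (ρ s * q s + z s * g s) :=
      intervalIntegral.sub_le_integral_of_hasDeriv_right_of_le hL (g := fun s => z s * q s)
        (hz.mul hqc.continuousOn)
        (fun s hs => (hz' s hs).mul (hqder s).hasDerivWithinAt) hφc.integrableOn_Icc
        (fun s hs => by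
          have := mul_le_mul_of_nonneg_right (hz'ρ s hs) (hq0 s (Set.Ioo_subset_Icc_self hs))
          linarith)
    have hi1 : IntervalIntegrable (fun s => ρ s * y s) volume 0 L :=
      (hρ.mul hyc).intervalIntegrable_zero hL
    have hi2 : IntervalIntegrable (fun s => z s * f s) volume 0 L :=
      hf.continuousOn_mul (by rwa [Set.uIcc_of_le hL])
    have hdiff : (∫ s in (0 : ℝ)..L, (ρ s * q s + z s * g s)) -
        ∫ s in (0 : ℝ)..L, (ρ s * y s + z s * f s) ≤ 2 * η * Bρ * L + Bz * η := by
      rw [← intervalIntegral.integral_sub (hφc.intervalIntegrable_zero hL) (hi1.add hi2)]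
      calc _ ≤ ∫ s in (0 : ℝ)..L, (2 * η * Bρ + Bz * ‖g s - f s‖) := by
            refine intervalIntegral.integral_mono_on hL
              ((hφc.intervalIntegrable_zero hL).sub (hi1.add hi2))
              (intervalIntegrable_const.add (((hgi _ _).sub hf).norm.const_mul Bz)) fun s hs => ?_
            have e1 : ρ s * (q s - y s) ≤ Bρ * (2 * η) := by
              refine (le_abs_self _).trans ?_
              rw [abs_mul]
              exact mul_le_mul (hBρ s hs) (hq2 s hs) (abs_nonneg _) hBρ0
            have e2 : z s * (g s - f s) ≤ Bz * ‖g s - f s‖ := by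
              refine (le_abs_self _).trans ?_
              rw [abs_mul]
              exact mul_le_mul_of_nonneg_right (hBz s hs) (abs_nonneg _)
            linarith
        _ = 2 * η * Bρ * L + Bz * ∫ s in (0 : ℝ)..L, ‖g s - f s‖ := by
            rw [intervalIntegral.integral_add intervalIntegrable_const
              (((hgi _ _).sub hf).norm.const_mul Bz), intervalIntegral.integral_const_mul]
            simp; ring
        _ ≤ _ := by gcongr
    have e3 : ∀ t ∈ Set.Icc 0 L, |z t * (q t - y t)| ≤ Bz * (2 * η) := fun t ht => by
      rw [abs_mul]
      exact mul_le_mul (hBz t ht) (hq2 t ht) (abs_nonneg _) hBz0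
    have e4 := (abs_le.1 (e3 L hLm)).1
    have e5 := (abs_le.1 (e3 0 h0m)).2
    linarith
  set C := 5 * Bz + 2 * Bρ * L with hC
  have hC0 : 0 ≤ C := by positivity
  refine le_of_forall_pos_le_add fun ε hε => ?_
  refine (key (ε / (C + 1)) (by positivity)).trans ?_
  have : ε / (C + 1) * C ≤ ε := by
    rw [div_mul_eq_mul_div, div_le_iff₀ (by positivity)]; nlinarith
  linarith

/-- Vector form of `mul_sub_mul_le_integral`. -/
theorem dotProduct_sub_dotProduct_le_integral {n : ℕ} {L : ℝ} (hL : 0 ≤ L)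
    {z z' ρ y f : ℝ → Fin n → ℝ} {y0 : Fin n → ℝ}
    (hz : ContinuousOn z (Set.Icc 0 L))
    (hz' : ∀ s ∈ Set.Ioo 0 L, HasDerivWithinAt z (z' s) (Set.Ioi s) s)
    (hρ : ContinuousOn ρ (Set.Icc 0 L)) (hz'ρ : ∀ s ∈ Set.Ioo 0 L, z' s ≤ ρ s)
    (hf : IntervalIntegrable f volume 0 L) (hyc : ContinuousOn y (Set.Icc 0 L))
    (hy : ∀ t ∈ Set.Icc 0 L, y t = y0 + ∫ s in (0 : ℝ)..t, f s)
    (hy0 : ∀ t ∈ Set.Icc 0 L, 0 ≤ y t) :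
    z L ⬝ᵥ y L - z 0 ⬝ᵥ y 0 ≤ ∫ s in (0 : ℝ)..L, (ρ s ⬝ᵥ y s + z s ⬝ᵥ f s) := by
  have hfi : ∀ i, IntervalIntegrable (fun s => f s i) volume 0 L := fun i => by
    rw [intervalIntegrable_iff_integrableOn_Icc_of_le hL] at hf ⊢
    exact hf.eval i
  have happ : ∀ {g : ℝ → Fin n → ℝ}, ContinuousOn g (Set.Icc 0 L) → ∀ i,
      ContinuousOn (fun s => g s i) (Set.Icc 0 L) := fun hg i =>
    (continuous_apply i).comp_continuousOn hg
  have hcomp : ∀ i, z L i * y L i - z 0 i * y 0 i ≤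
      ∫ s in (0 : ℝ)..L, (ρ s i * y s i + z s i * f s i) := fun i => by
    refine mul_sub_mul_le_integral hL (y0 := y0 i) (z := fun s => z s i) (z' := fun s => z' s i)
      (ρ := fun s => ρ s i) (y := fun s => y s i) (f := fun s => f s i)
      (happ hz i) (fun s hs => (hasDerivWithinAt_pi.1 (hz' s hs)) i) (happ hρ i)
      (fun s hs => hz'ρ s hs i) (hfi i) (fun t ht => ?_) (fun t ht => hy0 t ht i)
    rw [hy t ht, Pi.add_apply]
    congr 1
    have ht' := intervalIntegrable_left_of_mem hf ht
    rw [intervalIntegrable_iff_integrableOn_Ioc_of_le ht.1] at ht'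
    rw [intervalIntegral.integral_of_le ht.1, intervalIntegral.integral_of_le ht.1]
    exact (eval_integral fun j => ht'.eval j) i
  have hint : ∀ i ∈ Finset.univ,
      IntervalIntegrable (fun s => ρ s i * y s i + z s i * f s i) volume 0 L :=
    fun i _ => (((happ hρ i).mul (happ hyc i)).intervalIntegrable_zero hL).add
      ((hfi i).continuousOn_mul (by rw [Set.uIcc_of_le hL]; exact happ hz i))
  calc z L ⬝ᵥ y L - z 0 ⬝ᵥ y 0 = ∑ i, (z L i * y L i - z 0 i * y 0 i) := by
        simp [dotProduct, Finset.sum_sub_distrib]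
    _ ≤ ∑ i, ∫ s in (0 : ℝ)..L, (ρ s i * y s i + z s i * f s i) :=
        Finset.sum_le_sum fun i _ => hcomp i
    _ = _ := by
        rw [← intervalIntegral.integral_finsetSum hint]
        simp [dotProduct, Finset.sum_add_distrib]

theorem ContinuousOn.dotProduct_fun {n : ℕ} {y z : ℝ → Fin n → ℝ} {s : Set ℝ}
    (hy : ContinuousOn y s) (hz : ContinuousOn z s) :
    ContinuousOn (fun t => y t ⬝ᵥ z t) s :=
  continuousOn_finsetSum (f := fun i t => y t i * z t i) Finset.univ fun i _ =>
    ((continuous_apply i).comp_continuousOn hy).mul ((continuous_apply i).comp_continuousOn hz)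

theorem IntervalIntegrable.dotProduct_fun {n : ℕ} {y z : ℝ → Fin n → ℝ} {a b : ℝ} (hab : a ≤ b)
    (hy : ContinuousOn y (Set.Icc a b)) (hz : IntervalIntegrable z volume a b) :
    IntervalIntegrable (fun t => y t ⬝ᵥ z t) volume a b := by
  rw [intervalIntegrable_iff_integrableOn_Icc_of_le hab] at *
  exact integrable_finsetSum (f := fun i t => y t i * z t i) Finset.univ fun i _ =>
    IntegrableOn.continuousOn_mul ((continuous_apply i).comp_continuousOn hy)
      (hz.eval i) isCompact_Icc

theorem dotProduct_nonneg_of_pi_nonneg {n : ℕ} {v w : Fin n → ℝ} (hv : 0 ≤ v) (hw : 0 ≤ w) :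
    0 ≤ v ⬝ᵥ w := Finset.sum_nonneg fun i _ => mul_nonneg (hv i) (hw i)

theorem dotProduct_mono_left {n : ℕ} {a b v : Fin n → ℝ} (hab : a ≤ b) (hv : 0 ≤ v) :
    a ⬝ᵥ v ≤ b ⬝ᵥ v := Finset.sum_le_sum fun i _ => mul_le_mul_of_nonneg_right (hab i) (hv i)

theorem abs_dotProduct_le {n : ℕ} (v w : Fin n → ℝ) : |v ⬝ᵥ w| ≤ n * ‖v‖ * ‖w‖ := by
  calc |v ⬝ᵥ w| ≤ ∑ i, |v i * w i| := Finset.abs_sum_le_sum_abs _ _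
    _ ≤ ∑ _i : Fin n, ‖v‖ * ‖w‖ := by
        refine Finset.sum_le_sum fun i _ => ?_
        rw [abs_mul]
        exact mul_le_mul (norm_le_pi_norm v i) (norm_le_pi_norm w i) (abs_nonneg _) (norm_nonneg _)
    _ = _ := by simp; ring

/-! ### Dissipation along a flow and the sign of the delay term. -/

namespace ImpulsiveDelaySystem

variable {n pc pd qc qd : ℕ}

/-- The vector function `Z` satisfies the flow inequalities of the stability certificate on
`[0, L]`, with supply rate `γ`, and is nonnegative at `L`. -/
structure IsStorage (S : ImpulsiveDelaySystem n pc pd qc qd) (γ L : ℝ) (Z Z' : ℝ → Fin n → ℝ) :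
    Prop where
  cont : ContinuousOn Z (Set.Icc 0 L)
  deriv : ∀ s ∈ Set.Ioo 0 L, HasDerivWithinAt Z (Z' s) (Set.Ioi s) s
  flow_x : ∀ s ∈ Set.Ioo 0 L, Z' s + (Z s ᵥ* (S.A s + S.Gc s) + 1 ᵥ* (S.Cc + S.Hc)) ≤ 0
  flow_w : ∀ s ∈ Set.Icc 0 L, Z s ᵥ* S.Ec s + 1 ᵥ* S.Fc ≤ fun _ => γ
  final_nonneg : ∀ v, 0 ≤ v → 0 ≤ Z L ⬝ᵥ v

/-- The weight of the delayed state in the storage functional. -/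
noncomputable def delayWeight (S : ImpulsiveDelaySystem n pc pd qc qd) (Z : ℝ → Fin n → ℝ) (s : ℝ)
    (v : Fin n → ℝ) : ℝ :=
  Z s ⬝ᵥ (S.Gc s *ᵥ v) + 1 ⬝ᵥ (S.Hc *ᵥ v)

variable {S : ImpulsiveDelaySystem n pc pd qc qd} {γ L : ℝ} {Z Z' : ℝ → Fin n → ℝ}

theorem continuousOn_delayWeight (hZ : ContinuousOn Z (Set.Icc 0 L)) {u : ℝ → Fin n → ℝ}
    (hu : ContinuousOn u (Set.Icc 0 L)) :
    ContinuousOn (fun s => S.delayWeight Z s (u s)) (Set.Icc 0 L) :=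
  (hZ.dotProduct_fun ((S.continuousOn_Gc_Icc L).mulVec hu)).add
    (continuousOn_const.dotProduct_fun (continuousOn_const.mulVec hu))

theorem exists_abs_delayWeight_le (hZ : ContinuousOn Z (Set.Icc 0 L)) (hL : 0 ≤ L) :
    ∃ B, 0 ≤ B ∧ ∀ s ∈ Set.Icc 0 L, ∀ v, |S.delayWeight Z s v| ≤ B * ‖v‖ := by
  obtain ⟨K, hK, hGc⟩ := exists_norm_mulVec_le isCompact_Icc (S.continuousOn_Gc_Icc L)
  obtain ⟨K', hK', hHc⟩ := exists_norm_mulVec_le (A := fun _ => S.Hc) (isCompact_Icc (a := 0) (b := L))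
    continuousOn_const
  obtain ⟨M, hM⟩ := isCompact_Icc.exists_bound_of_continuousOn hZ
  have hM0 : 0 ≤ M := (norm_nonneg _).trans (hM 0 ⟨le_rfl, hL⟩)
  refine ⟨n * M * K + qc * ‖(1 : Fin qc → ℝ)‖ * K', by positivity, fun s hs v => ?_⟩
  calc |S.delayWeight Z s v| ≤ |Z s ⬝ᵥ (S.Gc s *ᵥ v)| + |1 ⬝ᵥ (S.Hc *ᵥ v)| := abs_add_le _ _
    _ ≤ n * ‖Z s‖ * ‖S.Gc s *ᵥ v‖ + qc * ‖(1 : Fin qc → ℝ)‖ * ‖S.Hc *ᵥ v‖ :=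
        add_le_add (abs_dotProduct_le _ _) (abs_dotProduct_le _ _)
    _ ≤ n * M * (K * ‖v‖) + qc * ‖(1 : Fin qc → ℝ)‖ * (K' * ‖v‖) := by
        gcongr
        · exact hM s hs
        · exact hGc s hs v
        · exact hHc s hs v
    _ = _ := by ring

/-- Dissipation inequality along one flow interval. -/
theorem IsStorage.dissipation (hZ : S.IsStorage γ L Z Z') (hL : 0 ≤ L) {x0 : Fin n → ℝ}
    {y u : ℝ → Fin n → ℝ} {w : ℝ → Fin pc → ℝ} (hu : ContinuousOn u (Set.Icc 0 L))
    (hw : IntervalIntegrable w volume 0 L) (hw0 : ∀ s ∈ Set.Icc 0 L, 0 ≤ w s)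
    (hy : IsFlow S.A L x0 (fun s => S.Gc s *ᵥ u s + S.Ec s *ᵥ w s) y)
    (hy0 : ∀ s ∈ Set.Icc 0 L, 0 ≤ y s) :
    Z L ⬝ᵥ y L + (∫ s in (0 : ℝ)..L, 1 ⬝ᵥ (S.Cc *ᵥ y s + S.Hc *ᵥ u s + S.Fc *ᵥ w s))
        + (∫ s in (0 : ℝ)..L, S.delayWeight Z s (y s))
      ≤ Z 0 ⬝ᵥ x0 + (∫ s in (0 : ℝ)..L, S.delayWeight Z s (u s))
        + γ * ∫ s in (0 : ℝ)..L, 1 ⬝ᵥ w s := by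
  have hA := S.continuousOn_A_Icc L
  have hG := S.continuousOn_Gc_Icc L
  -- A continuous majorant of `Z'`, provided by the flow inequality; it replaces `Z'`, whose
  -- integrability is unknown.
  set ρ : ℝ → Fin n → ℝ := fun s => -(Z s ᵥ* (S.A s + S.Gc s) + 1 ᵥ* (S.Cc + S.Hc)) with hρ
  have hρc : ContinuousOn ρ (Set.Icc 0 L) := by
    refine ContinuousOn.neg (ContinuousOn.add ?_ continuousOn_const)
    have := ContinuousOn.mulVec (A := fun s => (S.A s + S.Gc s)ᵀ) (y := Z)
      ((continuous_id.matrix_transpose).comp_continuousOn (hA.add hG)) hZ.cont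
    simpa only [mulVec_transpose] using this
  have hEw : IntervalIntegrable (fun s => S.Ec s *ᵥ w s) volume 0 L :=
    IntervalIntegrable.mulVec hL (S.continuousOn_Ec_Icc L) hw
  have hfor : IntervalIntegrable (fun s => S.Gc s *ᵥ u s + S.Ec s *ᵥ w s) volume 0 L :=
    ((hG.mulVec hu).intervalIntegrable_zero hL).add hEw
  have hfield : IntervalIntegrable
      (fun s => S.A s *ᵥ y s + (S.Gc s *ᵥ u s + S.Ec s *ᵥ w s)) volume 0 L :=
    ((hA.mulVec hy.cont).intervalIntegrable_zero hL).add hfor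
  have h := dotProduct_sub_dotProduct_le_integral hL hZ.cont hZ.deriv hρc
    (fun s hs => by
      have := hZ.flow_x s hs
      intro i
      have := this i
      simp only [Pi.add_apply, Pi.zero_apply] at this
      simp only [hρ, Pi.neg_apply, Pi.add_apply]
      linarith) hfield hy.cont hy.eq hy0
  rw [hy.apply_zero hL] at h
  have hzi : IntervalIntegrable (fun s => 1 ⬝ᵥ (S.Cc *ᵥ y s + S.Hc *ᵥ u s + S.Fc *ᵥ w s))
      volume 0 L := by
    refine IntervalIntegrable.dotProduct_fun (y := fun _ => 1) hL continuousOn_const ?_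
    refine IntervalIntegrable.add ?_ (IntervalIntegrable.mulVec hL continuousOn_const hw)
    exact ((continuousOn_const.mulVec hy.cont).add
      (continuousOn_const.mulVec hu)).intervalIntegrable_zero hL
  have hDy := (continuousOn_delayWeight (S := S) hZ.cont hy.cont).intervalIntegrable_zero hL
  have hDu := (continuousOn_delayWeight (S := S) hZ.cont hu).intervalIntegrable_zero hL
  have hwi : IntervalIntegrable (fun s => (1 : Fin pc → ℝ) ⬝ᵥ w s) volume 0 L :=
    IntervalIntegrable.dotProduct_fun (y := fun _ => 1) hL continuousOn_const hw
  have hle : ∫ s in (0 : ℝ)..L, (ρ s ⬝ᵥ y s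
        + Z s ⬝ᵥ (S.A s *ᵥ y s + (S.Gc s *ᵥ u s + S.Ec s *ᵥ w s)))
      ≤ ∫ s in (0 : ℝ)..L, (S.delayWeight Z s (u s) + γ * (1 ⬝ᵥ w s)
        - 1 ⬝ᵥ (S.Cc *ᵥ y s + S.Hc *ᵥ u s + S.Fc *ᵥ w s) - S.delayWeight Z s (y s)) := by
    refine intervalIntegral.integral_mono_on hL ?_ (((hDu.add (hwi.const_mul γ)).sub hzi).sub hDy)
      fun s hs => ?_
    · exact ((hρc.dotProduct_fun hy.cont).intervalIntegrable_zero hL).add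
        (IntervalIntegrable.dotProduct_fun hL hZ.cont hfield)
    -- Pointwise, the two integrands differ only in the input terms, which `flow_w` compares; the
    -- `A` terms cancel by the choice of `ρ`.
    · have h1 := dotProduct_mono_left (hZ.flow_w s hs) (hw0 s hs)
      have h2 : (fun _ : Fin pc => γ) ⬝ᵥ w s = γ * (1 ⬝ᵥ w s) := by
        simp [dotProduct, Finset.mul_sum]
      rw [h2] at h1
      simp only [hρ, delayWeight, neg_dotProduct, add_dotProduct, dotProduct_add, vecMul_add,
        ← dotProduct_mulVec] at h1 ⊢
      linarith
  rw [intervalIntegral.integral_sub ((hDu.add (hwi.const_mul γ)).sub hzi) hDy,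
    intervalIntegral.integral_sub (hDu.add (hwi.const_mul γ)) hzi,
    intervalIntegral.integral_add hDu (hwi.const_mul γ), intervalIntegral.integral_const_mul] at hle
  linarith

/-- The delay weight is nonnegative on average: feeding `u` through the flow again and again
decreases the integral and produces functions tending to zero. -/
theorem IsStorage.integral_delayWeight_nonneg (hZ : S.IsStorage γ L Z Z')
    (hpos : S.InternallyPositive) (hL : 0 < L) {u : ℝ → Fin n → ℝ}
    (hu : ContinuousOn u (Set.Icc 0 L)) (hu0 : ∀ s ∈ Set.Icc 0 L, 0 ≤ u s) :
    0 ≤ ∫ s in (0 : ℝ)..L, S.delayWeight Z s (u s) := by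
  obtain ⟨B, hB, hBw⟩ := exists_abs_delayWeight_le (S := S) hZ.cont hL.le
  obtain ⟨K, hK, hAK⟩ := exists_norm_mulVec_le isCompact_Icc (S.continuousOn_A_Icc L)
  obtain ⟨K', hK', hGK⟩ := exists_norm_mulVec_le isCompact_Icc (S.continuousOn_Gc_Icc L)
  obtain ⟨C, hC⟩ := isCompact_Icc.exists_bound_of_continuousOn hu
  have hC0 : 0 ≤ C := (norm_nonneg _).trans (hC 0 ⟨le_rfl, hL.le⟩)
  -- One passage through the flow gives `‖y s‖ ≤ E * ∫ ‖u‖` over `[0, s]`.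
  set E : ℝ := Real.exp (K * L) * K' with hE
  have hE0 : 0 ≤ E := by positivity
  -- Here `j` counts passages already made and `m` those still to come. Each passage integrates the
  -- bound once, turning `s^j / j!` into `s^(j+1) / (j+1)!`.
  have key : ∀ m j (u : ℝ → Fin n → ℝ), ContinuousOn u (Set.Icc 0 L) →
      (∀ s ∈ Set.Icc 0 L, 0 ≤ u s) →
      (∀ s ∈ Set.Icc 0 L, ‖u s‖ ≤ C * ((E * s) ^ j / j.factorial)) →
      -(L * B * C * ((E * L) ^ (j + m) / (j + m).factorial)) ≤
        ∫ s in (0 : ℝ)..L, S.delayWeight Z s (u s) := by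
    intro m
    induction m with
    | zero =>
      intro j u hu _ hub
      have h := intervalIntegral.norm_integral_le_of_norm_le_const (a := 0) (b := L)
        (f := fun s => S.delayWeight Z s (u s)) (C := B * (C * ((E * L) ^ j / j.factorial)))
        fun s hs => by
          rw [Set.uIoc_of_le hL.le] at hs
          have hs' : s ∈ Set.Icc 0 L := ⟨hs.1.le, hs.2⟩
          refine (hBw s hs' _).trans ?_
          gcongr
          refine (hub s hs').trans ?_
          have := hs'.1
          have := hs'.2
          gcongr
      rw [Real.norm_eq_abs, sub_zero, abs_of_pos hL] at h
      have := (abs_le.1 h).1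
      rw [add_zero]
      linarith
    | succ m ih =>
      intro j u hu hu0 hub
      have hGu := ((S.continuousOn_Gc_Icc L).mulVec hu).intervalIntegrable_zero hL.le
      obtain ⟨y, hy⟩ := exists_isFlow hL.le (S.continuousOn_A_Icc L) 0 hGu
      obtain ⟨hy0, hz, -, -⟩ := hpos.flow_nonneg hL hu le_rfl hu0 hy (le_refl 0)
      have hyb : ∀ s ∈ Set.Icc 0 L, ‖y s‖ ≤ C * ((E * s) ^ (j + 1) / (j + 1).factorial) := by
        intro s hs
        have h1 := hy.norm_le hK (S.continuousOn_A_Icc L) hAK hGu s hs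
        rw [norm_zero, zero_add] at h1
        have h2 : ∫ r in (0 : ℝ)..s, ‖S.Gc r *ᵥ u r‖
            ≤ ∫ r in (0 : ℝ)..s, K' * C * E ^ j / j.factorial * r ^ j := by
          refine intervalIntegral.integral_mono_on hs.1 (intervalIntegrable_left_of_mem hGu hs).norm
            (Continuous.intervalIntegrable (by fun_prop) _ _) fun r hr => ?_
          have hr' : r ∈ Set.Icc 0 L := ⟨hr.1, hr.2.trans hs.2⟩
          refine (hGK r hr' _).trans ?_
          refine (mul_le_mul_of_nonneg_left (hub r hr') hK').trans (le_of_eq ?_)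
          rw [mul_pow]; ring
        rw [intervalIntegral.integral_const_mul, integral_pow] at h2
        have hs0 := hs.1
        calc ‖y s‖ ≤ (K' * C * E ^ j / j.factorial * ((s ^ (j + 1) - 0 ^ (j + 1)) / (j + 1)))
              * Real.exp (K * L) := by
              refine h1.trans ?_
              have : K * s ≤ K * L := by gcongr; exact hs.2
              refine mul_le_mul h2 (Real.exp_le_exp.2 this) (Real.exp_pos _).le ?_
              rw [zero_pow (Nat.succ_ne_zero j), sub_zero]
              positivity
          _ = _ := by
              have hEj : E ^ (j + 1) = E ^ j * (Real.exp (K * L) * K') := by rw [pow_succ]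
              rw [zero_pow (Nat.succ_ne_zero j), sub_zero, Nat.factorial_succ, mul_pow E, hEj]
              push_cast
              field_simp
      have h3 := ih (j + 1) y hy.cont hy0 hyb
      -- Zero initial state and zero input: the integral for `u` dominates the one for `y` plus two
      -- nonnegative terms, the final storage and the output.
      have hd := hZ.dissipation hL.le hu (w := 0) IntervalIntegrable.zero
        (fun _ _ => le_rfl) (hy.congr_forcing fun s _ => by simp) hy0
      have h4 := hZ.final_nonneg _ (hy0 L ⟨hL.le, le_rfl⟩)
      have h5 : 0 ≤ ∫ s in (0 : ℝ)..L,
          1 ⬝ᵥ (S.Cc *ᵥ y s + S.Hc *ᵥ u s + S.Fc *ᵥ (0 : ℝ → Fin pc → ℝ) s) := by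
        refine intervalIntegral.integral_nonneg hL.le fun s hs => ?_
        refine dotProduct_nonneg_of_pi_nonneg (fun _ => zero_le_one) ?_
        simpa using hpos.outputC_nonneg (hy0 s hs) (hu0 s hs)
      simp only [dotProduct_zero, Pi.zero_apply, intervalIntegral.integral_zero, mul_zero,
        add_zero, zero_add] at hd h5
      rw [show j + (m + 1) = j + 1 + m by ring]
      linarith
  have hlim : Tendsto (fun m : ℕ => -(L * B * C * ((E * L) ^ m / m.factorial))) atTop (𝓝 0) := by
    have := ((FloorSemiring.tendsto_pow_div_factorial_atTop (E * L)).const_mul (L * B * C)).neg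
    simpa using this
  refine le_of_tendsto hlim (Eventually.of_forall fun m => ?_)
  have := key m 0 u hu hu0 fun s hs => by simpa using hC s hs
  simpa using this

end ImpulsiveDelaySystem

/-! ### Norms, periodic dwell-time sequences and delayed sums. -/

theorem l1norm_nonneg {m : ℕ} (v : Fin m → ℝ) : 0 ≤ l1norm v :=
  Finset.sum_nonneg fun _ _ => abs_nonneg _

theorem norm_le_l1norm {m : ℕ} (v : Fin m → ℝ) : ‖v‖ ≤ l1norm v := by
  rw [pi_norm_le_iff_of_nonneg (l1norm_nonneg v)]
  exact fun i => Finset.single_le_sum (f := fun i => |v i|) (fun _ _ => abs_nonneg _)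
    (Finset.mem_univ i)

theorem l1norm_le_card_mul_norm {m : ℕ} (v : Fin m → ℝ) : l1norm v ≤ m * ‖v‖ := by
  calc l1norm v ≤ ∑ _i : Fin m, ‖v‖ := Finset.sum_le_sum fun i _ => norm_le_pi_norm v i
    _ = _ := by simp

theorem one_dotProduct_eq_l1norm {m : ℕ} {v : Fin m → ℝ} (hv : 0 ≤ v) : 1 ⬝ᵥ v = l1norm v := by
  simp only [dotProduct, Pi.one_apply, one_mul, l1norm]
  exact Finset.sum_congr rfl fun i _ => (abs_of_nonneg (hv i)).symm

theorem continuous_l1norm {m : ℕ} : Continuous (l1norm : (Fin m → ℝ) → ℝ) := by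
  unfold l1norm; fun_prop

/-- The data extracted from a periodic dwell-time sequence: the delay is a multiple of its
period. -/
theorem periodicMinDwell.exists_period {Tbar hc : ℝ} {T : ℕ → ℝ}
    (hT : T ∈ periodicMinDwell Tbar hc) : ∃ N, 0 < N ∧ (∀ k, Tbar ≤ T k) ∧
      ∀ k, impulseTime T (k + N) = impulseTime T k + hc := by
  obtain ⟨q, α, hq, hα, ⟨β, hβ⟩, hsum⟩ := hT
  have hTk : ∀ k, T k = β (k % q) := fun k => by
    rw [← (hβ _ (Nat.mod_lt k hq)).2 (k / q), Nat.div_add_mod]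
  have hper : ∀ k, T (k + q) = T k := fun k => by rw [hTk, hTk k, Nat.add_mod_right]
  have hq1 : ∀ k, impulseTime T (k + q) = impulseTime T k + hc / α := fun k => by
    induction k with
    | zero => rw [zero_add, impulseTime_zero, zero_add]; exact hsum
    | succ k ih =>
      rw [show k + 1 + q = k + q + 1 by ring, impulseTime_succ, ih, hper, impulseTime_succ]; ring
  -- One period lasts `hc / α`, so `α` periods of `q` intervals fill the delay.
  refine ⟨α * q, by positivity, fun k => ?_, ?_⟩
  · rw [hTk]; exact (hβ _ (Nat.mod_lt k hq)).1
  · have h : ∀ (a : ℕ) k, impulseTime T (k + a * q) = impulseTime T k + a * (hc / α) := by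
      intro a
      induction a with
      | zero => simp
      | succ a ih =>
        intro k
        rw [show k + (a + 1) * q = k + a * q + q by ring, hq1, ih]; push_cast; ring
    intro k
    have : (α : ℝ) ≠ 0 := by positivity
    rw [h]; field_simp

theorem isDwellSequence_of_le {Tbar : ℝ} (hTbar : 0 < Tbar) {T : ℕ → ℝ} (hT : ∀ k, Tbar ≤ T k) :
    IsDwellSequence T := by
  refine ⟨fun k => hTbar.trans_le (hT k), ?_⟩
  refine tendsto_atTop_mono (f := fun k : ℕ => (k : ℝ) * Tbar) (fun k => ?_)
    (tendsto_natCast_atTop_atTop.atTop_mul_const hTbar)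
  calc (k : ℝ) * Tbar = ∑ _i ∈ Finset.range k, Tbar := by simp
    _ ≤ _ := Finset.sum_le_sum fun i _ => hT i

theorem integral_congr_Ioc {E : Type*} [NormedAddCommGroup E] [NormedSpace ℝ E] {f g : ℝ → E}
    {L : ℝ} (hL : 0 ≤ L) (h : ∀ s ∈ Set.Ioc 0 L, f s = g s) :
    ∫ s in (0 : ℝ)..L, f s = ∫ s in (0 : ℝ)..L, g s :=
  intervalIntegral.integral_congr_ae (Eventually.of_forall fun s hs => by
    rw [Set.uIoc_of_le hL] at hs; exact h s hs)

/-- Summation of a delayed nonnegative sequence. -/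
theorem sum_delayed_le {a b : ℕ → ℝ} {N : ℕ} (hb : ∀ k, 0 ≤ b k) (hab : ∀ k, a (k + N) = b k)
    (M : ℕ) :
    ∑ k ∈ Finset.range M, a k
      ≤ ∑ k ∈ Finset.range N, |a k| + ∑ k ∈ Finset.range M, b k := by
  calc ∑ k ∈ Finset.range M, a k ≤ ∑ k ∈ Finset.range M, |a k| :=
        Finset.sum_le_sum fun k _ => le_abs_self _
    _ ≤ ∑ k ∈ Finset.range (N + M), |a k| :=
        Finset.sum_le_sum_of_subset_of_nonneg
          (Finset.range_mono (Nat.le_add_left _ _)) fun _ _ _ => abs_nonneg _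
    _ = _ := by
        rw [Finset.sum_range_add]
        congr 1
        exact Finset.sum_congr rfl fun k _ => by rw [add_comm, hab, abs_of_nonneg (hb k)]

/-! ### Certificates and the summed storage inequality. -/

namespace ImpulsiveDelaySystem

variable {n pc pd qc qd : ℕ}

/-- A certificate consisting of a storage weight for the flow and inequalities at the jumps. -/
structure IsCertificate (S : ImpulsiveDelaySystem n pc pd qc qd) (Tbar ε γ : ℝ)
    (Z Z' : ℝ → Fin n → ℝ) : Prop where
  storage : ∀ L, Tbar ≤ L → S.IsStorage γ L Z Z'
  eventually_const : ∀ τ, Tbar ≤ τ → Z τ = Z Tbar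
  init_nonneg : 0 ≤ Z 0
  jump : ∀ v, 0 ≤ v → Z 0 ⬝ᵥ ((S.J + S.Gd) *ᵥ v) + 1 ⬝ᵥ ((S.Cd + S.Hd) *ᵥ v) + ε * (1 ⬝ᵥ v)
    ≤ Z Tbar ⬝ᵥ v
  jump_w : Z 0 ᵥ* S.Ed + 1 ᵥ* S.Fd ≤ fun _ => γ

theorem bddAbove_l1norm_range {hc : ℝ} {φ : ℝ → Fin n → ℝ}
    (hφ : ContinuousOn φ (Set.Icc (-hc) 0)) :
    BddAbove (Set.range fun s : Set.Icc (-hc) 0 => l1norm (φ s)) := by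
  have h := isCompact_Icc.bddAbove_image (continuous_l1norm.comp_continuousOn hφ)
  rwa [Set.image_eq_range] at h

theorem initialNorm_nonneg (hc : ℝ) (hd : ℕ) (φ : ℝ → Fin n → ℝ) (ψ : ℕ → Fin n → ℝ) :
    0 ≤ initialNorm hc hd φ ψ :=
  add_nonneg (Real.iSup_nonneg fun _ => l1norm_nonneg _) (Finset.sum_nonneg fun _ _ => l1norm_nonneg _)

theorem l1norm_le_initialNorm {hc : ℝ} (hd : ℕ) {φ : ℝ → Fin n → ℝ} (ψ : ℕ → Fin n → ℝ)
    (hφ : ContinuousOn φ (Set.Icc (-hc) 0)) {s : ℝ} (hs : s ∈ Set.Icc (-hc) 0) :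
    l1norm (φ s) ≤ initialNorm hc hd φ ψ :=
  (le_ciSup (bddAbove_l1norm_range hφ) ⟨s, hs⟩).trans
    (le_add_of_nonneg_right (Finset.sum_nonneg fun _ _ => l1norm_nonneg _))

theorem l1norm_sample_le_initialNorm (hc : ℝ) {hd : ℕ} (φ : ℝ → Fin n → ℝ) (ψ : ℕ → Fin n → ℝ)
    {j : ℕ} (hj : j ∈ Finset.Ico 1 hd) : l1norm (ψ j) ≤ initialNorm hc hd φ ψ :=
  (Finset.single_le_sum (f := fun j => l1norm (ψ j)) (fun _ _ => l1norm_nonneg _) hj).trans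
    (le_add_of_nonneg_left (Real.iSup_nonneg fun _ => l1norm_nonneg _))

/-- The weight of the delayed samples in the storage functional. -/
noncomputable def sampleWeight (S : ImpulsiveDelaySystem n pc pd qc qd) (Z : ℝ → Fin n → ℝ)
    (v : Fin n → ℝ) : ℝ :=
  Z 0 ⬝ᵥ (S.Gd *ᵥ v) + 1 ⬝ᵥ (S.Hd *ᵥ v)

variable {S : ImpulsiveDelaySystem n pc pd qc qd} {Tbar ε γ : ℝ} {Z Z' : ℝ → Fin n → ℝ}

theorem exists_abs_sampleWeight_le (S : ImpulsiveDelaySystem n pc pd qc qd) (Z : ℝ → Fin n → ℝ) :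
    ∃ B, 0 ≤ B ∧ ∀ v, |S.sampleWeight Z v| ≤ B * ‖v‖ := by
  obtain ⟨K, hK, hGd⟩ := exists_norm_mulVec_le (A := fun _ => S.Gd) (isCompact_singleton (x := (0 : ℝ)))
    continuousOn_const
  obtain ⟨K', hK', hHd⟩ := exists_norm_mulVec_le (A := fun _ => S.Hd) (isCompact_singleton (x := (0 : ℝ)))
    continuousOn_const
  refine ⟨n * ‖Z 0‖ * K + qd * ‖(1 : Fin qd → ℝ)‖ * K', by positivity, fun v => ?_⟩
  calc |S.sampleWeight Z v| ≤ |Z 0 ⬝ᵥ (S.Gd *ᵥ v)| + |1 ⬝ᵥ (S.Hd *ᵥ v)| := abs_add_le _ _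
    _ ≤ n * ‖Z 0‖ * ‖S.Gd *ᵥ v‖ + qd * ‖(1 : Fin qd → ℝ)‖ * ‖S.Hd *ᵥ v‖ :=
        add_le_add (abs_dotProduct_le _ _) (abs_dotProduct_le _ _)
    _ ≤ n * ‖Z 0‖ * (K * ‖v‖) + qd * ‖(1 : Fin qd → ℝ)‖ * (K' * ‖v‖) := by
        gcongr
        · exact hGd 0 rfl v
        · exact hHd 0 rfl v
    _ = _ := by ring

/-- The certificate bounds the jump as if the delayed sample were `v`. Replacing it by `d` costs
exactly the difference of their sample weights. -/
theorem IsCertificate.jump_inequality (hZ : S.IsCertificate Tbar ε γ Z Z') {v d : Fin n → ℝ}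
    {w : Fin pd → ℝ} (hv : 0 ≤ v) (hw : 0 ≤ w) :
    Z 0 ⬝ᵥ (S.J *ᵥ v + S.Gd *ᵥ d + S.Ed *ᵥ w) + 1 ⬝ᵥ (S.Cd *ᵥ v + S.Hd *ᵥ d + S.Fd *ᵥ w)
        + S.sampleWeight Z v + ε * (1 ⬝ᵥ v)
      ≤ Z Tbar ⬝ᵥ v + S.sampleWeight Z d + γ * (1 ⬝ᵥ w) := by
  have h1 := hZ.jump v hv
  have h2 := dotProduct_mono_left hZ.jump_w hw
  have h3 : (fun _ : Fin pd => γ) ⬝ᵥ w = γ * (1 ⬝ᵥ w) := by simp [dotProduct, Finset.mul_sum]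
  rw [h3, add_dotProduct, ← dotProduct_mulVec, ← dotProduct_mulVec] at h2
  simp only [add_mulVec, dotProduct_add, sampleWeight] at h1 h2 ⊢
  linarith

section Periodic

variable {hc : ℝ} {hd : ℕ} {T : ℕ → ℝ} {φ : ℝ → Fin n → ℝ}
    {ψ : ℕ → Fin n → ℝ} {wc : ℝ → Fin pc → ℝ} {wd : ℕ → Fin pd → ℝ} {x : ℝ → Fin n → ℝ} {N : ℕ}

/-- This makes the method of steps available. -/
theorem le_delay_of_period (hT : IsDwellSequence T) (hN : 0 < N)
    (hper : ∀ k, impulseTime T (k + N) = impulseTime T k + hc) (k : ℕ) : T k ≤ hc := by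
  have h1 := hper k
  have h2 := hT.strictMono.monotone (show k + 1 ≤ k + N by omega)
  rw [impulseTime_succ] at h2
  linarith

theorem dwell_add_period (hper : ∀ k, impulseTime T (k + N) = impulseTime T k + hc) (k : ℕ) :
    T (k + N) = T k := by
  have h1 := hper (k + 1)
  rw [show k + 1 + N = k + N + 1 by ring, impulseTime_succ, impulseTime_succ, hper] at h1
  linarith

theorem delayed_mem_Icc (hT : IsDwellSequence T)
    (hper : ∀ k, impulseTime T (k + N) = impulseTime T k + hc) {k : ℕ} (hk : k < N) {τ : ℝ}
    (hτ : τ ∈ Set.Icc 0 (T k)) : impulseTime T k + τ - hc ∈ Set.Icc (-hc) 0 := by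
  have h1 := hT.strictMono.monotone (show k + 1 ≤ N by omega)
  have h2 := hper 0
  rw [zero_add, impulseTime_zero] at h2
  rw [impulseTime_succ] at h1
  exact ⟨by linarith [hT.impulseTime_nonneg k, hτ.1], by linarith [hτ.2]⟩

/-- On every dwell interval the delayed state extends continuously to the closed interval. -/
theorem IsSolution.exists_delayed_continuousOn (hT : IsDwellSequence T)
    (hper : ∀ k, impulseTime T (k + N) = impulseTime T k + hc)
    (h : S.IsSolution hc hd T φ ψ wc wd x) (hφ : ContinuousOn φ (Set.Icc (-hc) 0)) (k : ℕ) :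
    ∃ u, ContinuousOn u (Set.Icc 0 (T k)) ∧
      (∀ τ ∈ Set.Ioc 0 (T k), x (impulseTime T k + τ - hc) = u τ) ∧
      ((∀ t, 0 ≤ t → 0 ≤ x t) → (∀ s ∈ Set.Icc (-hc) 0, 0 ≤ φ s) →
        ∀ τ ∈ Set.Icc 0 (T k), 0 ≤ u τ) := by
  rcases lt_or_ge k N with hk | hk
  · refine ⟨fun τ => φ (impulseTime T k + τ - hc),
      hφ.comp (Continuous.continuousOn (by fun_prop)) fun τ hτ => delayed_mem_Icc hT hper hk hτ,
      fun τ hτ => ?_, fun _ hφ0 τ hτ => hφ0 _ (delayed_mem_Icc hT hper hk hτ)⟩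
    exact h.initial _ (delayed_mem_Icc hT hper hk (Set.Ioc_subset_Icc_self hτ))
  · obtain ⟨j, rfl⟩ := Nat.exists_eq_add_of_le' hk
    rw [dwell_add_period hper]
    -- The delayed state is the piece `N` intervals earlier. At `τ = 0` its extension has the
    -- post-jump value.
    refine ⟨S.pieceExt hc hd T ψ wc wd x j, h.continuousOn_pieceExt hT j, fun τ hτ => ?_,
      fun hx _ => h.pieceExt_nonneg hT hx j⟩
    rw [hper, ← h.eq_pieceExt hτ]
    congr 1; ring

/-- Storage inequality along the `k`-th dwell interval. -/
theorem IsCertificate.flow_inequality (hZ : S.IsCertificate Tbar ε γ Z Z') (hT : IsDwellSequence T)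
    (hTbar : ∀ k, Tbar ≤ T k) (hper : ∀ k, impulseTime T (k + N) = impulseTime T k + hc)
    (h : S.IsSolution hc hd T φ ψ wc wd x) (hφ : ContinuousOn φ (Set.Icc (-hc) 0))
    (hwc : LocallyIntegrableOn wc (Set.Ici 0)) (hwc0 : ∀ t, 0 ≤ t → 0 ≤ wc t)
    (hx : ∀ t, 0 ≤ t → 0 ≤ x t) (k : ℕ) :
    Z Tbar ⬝ᵥ x (impulseTime T (k + 1))
        + (∫ τ in (0 : ℝ)..T k, 1 ⬝ᵥ S.outputC hc wc x (impulseTime T k + τ))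
        + (∫ τ in (0 : ℝ)..T k, S.delayWeight Z τ (x (impulseTime T k + τ)))
      ≤ Z 0 ⬝ᵥ S.postJump hd T ψ wd x k
        + (∫ τ in (0 : ℝ)..T k, S.delayWeight Z τ (x (impulseTime T k + τ - hc)))
        + γ * ∫ τ in (0 : ℝ)..T k, 1 ⬝ᵥ wc (impulseTime T k + τ) := by
  have hk := hT.1 k
  obtain ⟨u, huc, hxu, -⟩ := h.exists_delayed_continuousOn hT hper hφ k
  have hy := (h.isFlow_pieceExt hT k).congr_forcing
    (g := fun s => S.Gc s *ᵥ u s + S.Ec s *ᵥ wc (impulseTime T k + s)) fun s hs => by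
      rw [forcing, hxu s hs]
  have hd := (hZ.storage (T k) (hTbar k)).dissipation hk.le huc
    (intervalIntegrable_input_shift hT hwc k)
    (fun s hs => hwc0 _ (add_nonneg (hT.impulseTime_nonneg k) hs.1)) hy
    (h.pieceExt_nonneg hT hx k)
  rw [hZ.eventually_const _ (hTbar k), ← h.eq_pieceExt ⟨hk, le_rfl⟩, ← impulseTime_succ] at hd
  rw [integral_congr_Ioc (f := fun τ => 1 ⬝ᵥ S.outputC hc wc x (impulseTime T k + τ)) hk.le
      (fun s hs => by rw [outputC, h.eq_pieceExt hs, hxu s hs]),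
    integral_congr_Ioc (f := fun τ => S.delayWeight Z τ (x (impulseTime T k + τ))) hk.le
      (fun s hs => by rw [h.eq_pieceExt hs]),
    integral_congr_Ioc (f := fun τ => S.delayWeight Z τ (x (impulseTime T k + τ - hc))) hk.le
      (fun s hs => by rw [hxu s hs])]
  exact hd

/-- Summed storage inequality for nonnegative solutions. -/
theorem IsCertificate.exists_storage_bound (hZ : S.IsCertificate Tbar ε γ Z Z')
    (hpos : S.InternallyPositive) (hT : IsDwellSequence T)
    (hTbar : ∀ k, Tbar ≤ T k) (hN : 0 < N)
    (hper : ∀ k, impulseTime T (k + N) = impulseTime T k + hc) (hd : ℕ) :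
    ∃ C, 0 ≤ C ∧ ∀ (φ : ℝ → Fin n → ℝ) (ψ : ℕ → Fin n → ℝ) (wc : ℝ → Fin pc → ℝ)
      (wd : ℕ → Fin pd → ℝ) (x : ℝ → Fin n → ℝ),
      ContinuousOn φ (Set.Icc (-hc) 0) → LocallyIntegrableOn wc (Set.Ici 0) →
      (∀ s ∈ Set.Icc (-hc) 0, 0 ≤ φ s) → (∀ j, 0 ≤ ψ j) →
      (∀ t, 0 ≤ t → 0 ≤ wc t) → (∀ k, 0 ≤ wd k) →
      S.IsSolution hc hd T φ ψ wc wd x → ∀ M : ℕ,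
      ε * ∑ k ∈ Finset.range M, 1 ⬝ᵥ x (impulseTime T (k + 1))
          + ∑ k ∈ Finset.range M,
              (∫ τ in (0 : ℝ)..T k, 1 ⬝ᵥ S.outputC hc wc x (impulseTime T k + τ))
          + ∑ k ∈ Finset.range M, 1 ⬝ᵥ S.outputD hd T ψ wd x (k + 1)
        ≤ C * initialNorm hc hd φ ψ
          + γ * (∑ k ∈ Finset.range M, (∫ τ in (0 : ℝ)..T k, 1 ⬝ᵥ wc (impulseTime T k + τ))
            + ∑ k ∈ Finset.range M, 1 ⬝ᵥ wd (k + 1)) := by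
  have hTc := le_delay_of_period hT hN hper
  have hc0 : 0 ≤ hc := (hT.1 0).le.trans (hTc 0)
  obtain ⟨B, hB, hBw⟩ := exists_abs_delayWeight_le (S := S)
    (hZ.storage hc ((hTbar 0).trans (hTc 0))).cont hc0
  obtain ⟨B', hB', hBw'⟩ := exists_abs_sampleWeight_le S Z
  -- The three summands bound the initial storage `Z 0 ⬝ᵥ x 0`, the first `N` delayed integrals and
  -- the first `hd` delayed samples.
  refine ⟨n * ‖Z 0‖ + N * (B * hc) + hd * B', by positivity,
    fun φ ψ wc wd x hφ hwc hφ0 hψ0 hwc0 hwd0 h M => ?_⟩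
  obtain ⟨hx, -, -⟩ := hpos hc hd T ((hT.1 0).trans_le (hTc 0)) hT φ ψ wc wd x hφ hwc hφ0 hψ0 hwc0
    hwd0 h
  set I := initialNorm hc hd φ ψ with hI
  have hI0 : 0 ≤ I := initialNorm_nonneg _ _ _ _
  have hφI : ∀ s ∈ Set.Icc (-hc) 0, ‖φ s‖ ≤ I := fun s hs =>
    (norm_le_l1norm _).trans (l1norm_le_initialNorm hd ψ hφ hs)
  have h0mem : (0 : ℝ) ∈ Set.Icc (-hc) 0 := ⟨by linarith, le_rfl⟩
  have hx0 : x 0 = φ 0 := h.initial 0 h0mem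
  set t := impulseTime T with ht
  have hxt : ∀ k, 0 ≤ x (t k) := fun k => hx _ (hT.impulseTime_nonneg k)
  -- the delayed terms of the flow
  set a : ℕ → ℝ := fun k => ∫ τ in (0 : ℝ)..T k, S.delayWeight Z τ (x (t k + τ - hc)) with ha
  set b : ℕ → ℝ := fun k => ∫ τ in (0 : ℝ)..T k, S.delayWeight Z τ (x (t k + τ)) with hb
  have hab : ∀ k, a (k + N) = b k := fun k => by
    simp only [ha, hb, hper, dwell_add_period hper]
    congr 1; ext τ; congr 2; ring
  -- These signs let the weights of the current pieces absorb all delayed terms except the first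
  -- `N`.
  have hb0 : ∀ k, 0 ≤ b k := fun k => by
    have h1 := (hZ.storage _ (hTbar k)).integral_delayWeight_nonneg hpos (hT.1 k)
      (h.continuousOn_pieceExt hT k) (h.pieceExt_nonneg hT hx k)
    rwa [← integral_congr_Ioc (f := fun τ => S.delayWeight Z τ (x (t k + τ))) (hT.1 k).le
      (fun s hs => by rw [h.eq_pieceExt hs])] at h1
  have haI : ∀ k ∈ Finset.range N, |a k| ≤ B * hc * I := fun k hk => by
    have h1 := intervalIntegral.norm_integral_le_of_norm_le_const (a := 0) (b := T k)
      (f := fun τ => S.delayWeight Z τ (x (t k + τ - hc))) (C := B * I) fun τ hτ => by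
        rw [Set.uIoc_of_le (hT.1 k).le] at hτ
        refine (hBw τ ⟨hτ.1.le, hτ.2.trans (hTc k)⟩ _).trans ?_
        have hm := delayed_mem_Icc hT hper (Finset.mem_range.1 hk) (Set.Ioc_subset_Icc_self hτ)
        rw [h.initial _ hm]
        exact mul_le_mul_of_nonneg_left (hφI _ hm) hB
    rw [sub_zero, abs_of_pos (hT.1 k)] at h1
    refine h1.trans ?_
    calc B * I * T k ≤ B * I * hc := mul_le_mul_of_nonneg_left (hTc k) (by positivity)
      _ = _ := by ring
  have hsuma := sum_delayed_le hb0 hab M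
  have hsumaI : ∑ k ∈ Finset.range N, |a k| ≤ N * (B * hc) * I := by
    refine (Finset.sum_le_sum haI).trans (le_of_eq ?_)
    rw [Finset.sum_const, Finset.card_range, nsmul_eq_mul]; ring
  -- the delayed terms of the jumps
  set c : ℕ → ℝ := fun k => S.sampleWeight Z (sampledDelay hd T ψ x (k + 1)) with hcd
  set e : ℕ → ℝ := fun k => S.sampleWeight Z (x (t (k + 1))) with he
  -- The index is shifted by one because jumps start at `k = 1`.
  have hce : ∀ k, c (k + hd) = e k := fun k => by
    simp only [hcd, he, sampledDelay]
    rw [if_pos (by omega), show k + hd + 1 - hd = k + 1 by omega]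
  have he0 : ∀ k, 0 ≤ e k := fun k => add_nonneg
    (dotProduct_nonneg_of_pi_nonneg hZ.init_nonneg (hpos.Gd_nonneg (hxt _)))
    (dotProduct_nonneg_of_pi_nonneg (fun _ => zero_le_one) (hpos.Hd_nonneg (hxt _)))
  have hcI : ∀ k ∈ Finset.range hd, |c k| ≤ B' * I := fun k hk => by
    refine (hBw' _).trans (mul_le_mul_of_nonneg_left ?_ hB')
    rw [Finset.mem_range] at hk
    unfold sampledDelay
    split_ifs with hle
    -- Among the first `hd` samples only the last has a nonnegative index; it is `x(t_0)`, given by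
    -- `φ 0`.
    · rw [show k + 1 - hd = 0 by omega, impulseTime_zero, hx0]
      exact hφI 0 h0mem
    · exact (norm_le_l1norm _).trans
        (l1norm_sample_le_initialNorm hc φ ψ (Finset.mem_Ico.2 ⟨by omega, by omega⟩))
  have hsumc := sum_delayed_le he0 hce M
  have hsumcI : ∑ k ∈ Finset.range hd, |c k| ≤ hd * B' * I := by
    refine (Finset.sum_le_sum hcI).trans (le_of_eq ?_)
    rw [Finset.sum_const, Finset.card_range, nsmul_eq_mul]; ring
  -- telescoping
  have htel : ∀ M : ℕ, Z 0 ⬝ᵥ S.postJump hd T ψ wd x M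
      + ε * ∑ k ∈ Finset.range M, 1 ⬝ᵥ x (t (k + 1))
      + ∑ k ∈ Finset.range M, (∫ τ in (0 : ℝ)..T k, 1 ⬝ᵥ S.outputC hc wc x (t k + τ))
      + ∑ k ∈ Finset.range M, 1 ⬝ᵥ S.outputD hd T ψ wd x (k + 1)
      + ∑ k ∈ Finset.range M, b k + ∑ k ∈ Finset.range M, e k
      ≤ Z 0 ⬝ᵥ x 0 + ∑ k ∈ Finset.range M, a k + ∑ k ∈ Finset.range M, c k
      + γ * (∑ k ∈ Finset.range M, (∫ τ in (0 : ℝ)..T k, 1 ⬝ᵥ wc (t k + τ))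
        + ∑ k ∈ Finset.range M, 1 ⬝ᵥ wd (k + 1)) := by
    intro M
    induction M with
    | zero => simp [postJump]
    | succ M ih =>
      have h1 := hZ.flow_inequality hT hTbar hper h hφ hwc hwc0 hx M
      have h2 := hZ.jump_inequality (d := sampledDelay hd T ψ x (M + 1)) (hxt (M + 1))
        (hwd0 (M + 1))
      have h3 : S.postJump hd T ψ wd x (M + 1) = S.J *ᵥ x (t (M + 1))
          + S.Gd *ᵥ sampledDelay hd T ψ x (M + 1) + S.Ed *ᵥ wd (M + 1) := by simp [postJump, ht]
      simp only [Finset.sum_range_succ]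
      rw [h3]
      simp only [outputD] at ih ⊢
      rw [← ht] at h1 ih ⊢
      linarith
  have hfin : 0 ≤ Z 0 ⬝ᵥ S.postJump hd T ψ wd x M := by
    refine dotProduct_nonneg_of_pi_nonneg hZ.init_nonneg ?_
    rw [← pieceExt_zero (hc := hc) (wc := wc)]
    exact h.pieceExt_nonneg hT hx M 0 ⟨le_rfl, (hT.1 M).le⟩
  have hZ0 : Z 0 ⬝ᵥ x 0 ≤ n * ‖Z 0‖ * I := by
    refine (le_abs_self _).trans ((abs_dotProduct_le _ _).trans ?_)
    rw [hx0]
    exact mul_le_mul_of_nonneg_left (hφI 0 h0mem) (by positivity)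
  have := htel M
  linarith

end Periodic

end ImpulsiveDelaySystem

/-! ### Domination by nonnegative solutions. -/

/-- The componentwise absolute value. -/
def absVec {m : ℕ} (v : Fin m → ℝ) : Fin m → ℝ := fun i => |v i|

theorem absVec_nonneg {m : ℕ} (v : Fin m → ℝ) : 0 ≤ absVec v := fun i => abs_nonneg (v i)

theorem continuous_absVec {m : ℕ} : Continuous (absVec : (Fin m → ℝ) → Fin m → ℝ) := by
  unfold absVec; fun_prop

theorem l1norm_absVec {m : ℕ} (v : Fin m → ℝ) : l1norm (absVec v) = l1norm v := by
  simp [l1norm, absVec]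

theorem one_dotProduct_absVec {m : ℕ} (v : Fin m → ℝ) : 1 ⬝ᵥ absVec v = l1norm v := by
  rw [one_dotProduct_eq_l1norm (absVec_nonneg v), l1norm_absVec]

theorem absVec_add_nonneg {m : ℕ} (v : Fin m → ℝ) : 0 ≤ absVec v + v := fun i => by
  have := neg_abs_le (v i)
  simp only [absVec, Pi.zero_apply, Pi.add_apply]; linarith

theorem absVec_add_neg_nonneg {m : ℕ} (v : Fin m → ℝ) : 0 ≤ absVec v + -v := fun i => by
  have := le_abs_self (v i)
  simp only [absVec, Pi.zero_apply, Pi.add_apply, Pi.neg_apply]; linarith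

/-- Turns nonnegativity of `p + x` and `p - x` into a norm bound without separating positive and
negative parts. -/
theorem l1norm_le_one_dotProduct {m : ℕ} {p v : Fin m → ℝ} (h1 : 0 ≤ p + v) (h2 : 0 ≤ p + -v) :
    l1norm v ≤ 1 ⬝ᵥ p := by
  simp only [dotProduct, Pi.one_apply, one_mul, l1norm]
  refine Finset.sum_le_sum fun i _ => abs_le.2 ⟨?_, ?_⟩
  · have := h1 i; simp only [Pi.zero_apply, Pi.add_apply] at this; linarith
  · have := h2 i; simp only [Pi.zero_apply, Pi.add_apply, Pi.neg_apply] at this; linarith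

theorem MeasureTheory.IntegrableOn.absVec_comp {m : ℕ} {w : ℝ → Fin m → ℝ} {s : Set ℝ}
    (hw : IntegrableOn w s) : IntegrableOn (fun t => absVec (w t)) s :=
  Integrable.of_eval fun i => (hw.eval i).abs

theorem MeasureTheory.IntegrableOn.l1norm_comp {m : ℕ} {w : ℝ → Fin m → ℝ} {s : Set ℝ}
    (hw : IntegrableOn w s) : IntegrableOn (fun t => l1norm (w t)) s :=
  integrable_finsetSum (f := fun i t => |w t i|) Finset.univ fun i _ => (hw.eval i).abs

theorem IntervalIntegrable.l1norm_comp {m : ℕ} {w : ℝ → Fin m → ℝ} {a b : ℝ}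
    (hw : IntervalIntegrable w volume a b) :
    IntervalIntegrable (fun t => l1norm (w t)) volume a b :=
  ⟨IntegrableOn.l1norm_comp hw.1, IntegrableOn.l1norm_comp hw.2⟩

theorem MeasureTheory.IntegrableOn.locallyIntegrableOn_Ici {m : ℕ} {w : ℝ → Fin m → ℝ}
    (hw : IntegrableOn w (Set.Ioi 0)) : LocallyIntegrableOn w (Set.Ici 0) :=
  (Iff.mpr integrableOn_Ici_iff_integrableOn_Ioi hw).locallyIntegrableOn

theorem intervalIntegrable_of_shift {E : Type*} [NormedAddCommGroup E] {T : ℕ → ℝ} {f : ℝ → E}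
    (k : ℕ) (hf : IntervalIntegrable (fun τ => f (impulseTime T k + τ)) volume 0 (T k)) :
    IntervalIntegrable f volume (impulseTime T k) (impulseTime T (k + 1)) := by
  have := hf.comp_add_left (-impulseTime T k)
  simpa [impulseTime_succ, add_comm] using this

theorem sum_integral_shift {T : ℕ → ℝ} {f : ℝ → ℝ} (M : ℕ)
    (hf : ∀ k, IntervalIntegrable (fun τ => f (impulseTime T k + τ)) volume 0 (T k)) :
    ∑ k ∈ Finset.range M, (∫ τ in (0 : ℝ)..T k, f (impulseTime T k + τ))
      = ∫ t in (0 : ℝ)..impulseTime T M, f t := by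
  have h := intervalIntegral.sum_integral_adjacent_intervals (μ := volume) (f := f)
    (a := impulseTime T) (n := M) fun k _ => intervalIntegrable_of_shift k (hf k)
  rw [impulseTime_zero] at h
  rw [← h]
  refine Finset.sum_congr rfl fun k _ => ?_
  rw [intervalIntegral.integral_comp_add_left, add_zero, impulseTime_succ]

namespace ImpulsiveDelaySystem

variable {n pc pd qc qd : ℕ} {S : ImpulsiveDelaySystem n pc pd qc qd} {Tbar ε γ : ℝ}
  {Z Z' : ℝ → Fin n → ℝ} {hc : ℝ} {hd : ℕ} {T : ℕ → ℝ} {φ : ℝ → Fin n → ℝ}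
  {ψ : ℕ → Fin n → ℝ} {wc : ℝ → Fin pc → ℝ} {wd : ℕ → Fin pd → ℝ} {x : ℝ → Fin n → ℝ} {N : ℕ}

theorem initialNorm_absVec (hc : ℝ) (hd : ℕ) (φ : ℝ → Fin n → ℝ) (ψ : ℕ → Fin n → ℝ) :
    initialNorm hc hd (fun s => absVec (φ s)) (fun j => absVec (ψ j)) = initialNorm hc hd φ ψ := by
  simp only [initialNorm, l1norm_absVec]

/-- Every solution is dominated by the nonnegative solution whose data are the absolute values. -/
theorem InternallyPositive.exists_dominating (hpos : S.InternallyPositive) (hc0 : 0 < hc)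
    (hT : IsDwellSequence T) (hTc : ∀ k, T k ≤ hc) (hφ : ContinuousOn φ (Set.Icc (-hc) 0))
    (hwc : IntegrableOn wc (Set.Ioi 0)) (h : S.IsSolution hc hd T φ ψ wc wd x) :
    ∃ p, S.IsSolution hc hd T (fun s => absVec (φ s)) (fun j => absVec (ψ j))
        (fun t => absVec (wc t)) (fun k => absVec (wd k)) p ∧
      (∀ t, 0 ≤ t → l1norm (x t) ≤ 1 ⬝ᵥ p t) ∧
      (∀ t, 0 < t → l1norm (S.outputC hc wc x t)
        ≤ 1 ⬝ᵥ S.outputC hc (fun t => absVec (wc t)) p t) ∧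
      ∀ k, 1 ≤ k → l1norm (S.outputD hd T ψ wd x k)
        ≤ 1 ⬝ᵥ S.outputD hd T (fun j => absVec (ψ j)) (fun k => absVec (wd k)) p k := by
  have hφ' : ContinuousOn (fun s => absVec (φ s)) (Set.Icc (-hc) 0) :=
    continuous_absVec.comp_continuousOn hφ
  have hwl := hwc.locallyIntegrableOn_Ici
  have hwl' := hwc.absVec_comp.locallyIntegrableOn_Ici
  obtain ⟨p, hp⟩ := S.exists_isSolution hd hT hTc (fun j => absVec (ψ j))
    (fun k => absVec (wd k)) hφ' hwl'
  -- By superposition `p + x`, and below `p - x`, solve the system with nonnegative data, so their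
  -- states and outputs are nonnegative.
  obtain ⟨a1, a2, a3⟩ := hpos hc hd T hc0 hT _ _ _ _ _ (hφ'.add hφ) (hwl'.add hwl)
    (fun s _ => absVec_add_nonneg _) (fun j => absVec_add_nonneg _)
    (fun t _ => absVec_add_nonneg _) (fun k => absVec_add_nonneg _) (hp.add h)
  obtain ⟨b1, b2, b3⟩ := hpos hc hd T hc0 hT _ _ _ _ _ (hφ'.add hφ.neg) (hwl'.add hwl.neg)
    (fun s _ => absVec_add_neg_nonneg _) (fun j => absVec_add_neg_nonneg _)
    (fun t _ => absVec_add_neg_nonneg _) (fun k => absVec_add_neg_nonneg _) (hp.add h.neg)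
  refine ⟨p, hp, fun t ht => l1norm_le_one_dotProduct (a1 t ht) (b1 t ht), fun t ht => ?_,
    fun k hk => ?_⟩
  · have h1 := a2 t ht
    have h2 := b2 t ht
    rw [outputC_add] at h1 h2
    rw [outputC_neg] at h2
    exact l1norm_le_one_dotProduct h1 h2
  · have h1 : 0 ≤ S.outputD hd T ((fun j => absVec (ψ j)) + ψ) ((fun k => absVec (wd k)) + wd)
      (p + x) k := a3 k hk
    have h2 : 0 ≤ S.outputD hd T ((fun j => absVec (ψ j)) + -ψ) ((fun k => absVec (wd k)) + -wd)
      (p + -x) k := b3 k hk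
    rw [outputD_add] at h1 h2
    rw [outputD_neg] at h2
    exact l1norm_le_one_dotProduct h1 h2

theorem IsSolution.intervalIntegrable_outputC (hT : IsDwellSequence T)
    (hper : ∀ k, impulseTime T (k + N) = impulseTime T k + hc)
    (h : S.IsSolution hc hd T φ ψ wc wd x) (hφ : ContinuousOn φ (Set.Icc (-hc) 0))
    (hwc : LocallyIntegrableOn wc (Set.Ici 0)) (k : ℕ) :
    IntervalIntegrable (fun τ => S.outputC hc wc x (impulseTime T k + τ)) volume 0 (T k) := by
  have hk := (hT.1 k).le
  obtain ⟨u, huc, hxu, -⟩ := h.exists_delayed_continuousOn hT hper hφ k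
  have h1 := ((continuousOn_const (c := S.Cc)).mulVec (h.continuousOn_pieceExt hT k)).add
    ((continuousOn_const (c := S.Hc)).mulVec huc)
  refine ((h1.intervalIntegrable_zero hk).add (IntervalIntegrable.mulVec hk
    (continuousOn_const (c := S.Fc)) (intervalIntegrable_input_shift hT hwc k))).congr
    fun τ hτ => ?_
  rw [Set.uIoc_of_le hk] at hτ
  simp only [outputC, h.eq_pieceExt hτ, hxu τ hτ, Pi.add_apply]

/-! ### Stability, gain and construction of the certificate. -/

/-- Between impulses, a nonnegative solution without inputs is controlled by its value at the next
impulse time. -/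
theorem IsSolution.norm_le_next (hpos : S.InternallyPositive) (hT : IsDwellSequence T)
    (hper : ∀ k, impulseTime T (k + N) = impulseTime T k + hc) (hTc : ∀ k, T k ≤ hc)
    {K : ℝ} (hK : 0 ≤ K) (hAK : ∀ t ∈ Set.Icc 0 hc, ∀ v, ‖S.A t *ᵥ v‖ ≤ K * ‖v‖)
    (h : S.IsSolution hc hd T φ ψ 0 wd x) (hφ : ContinuousOn φ (Set.Icc (-hc) 0))
    (hφ0 : ∀ s ∈ Set.Icc (-hc) 0, 0 ≤ φ s) (hx : ∀ t, 0 ≤ t → 0 ≤ x t) (k : ℕ) {τ : ℝ}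
    (hτ : τ ∈ Set.Ioc 0 (T k)) :
    ‖x (impulseTime T k + τ)‖ ≤ Real.exp (K * hc) * ‖x (impulseTime T (k + 1))‖ := by
  have hk := hT.1 k
  obtain ⟨u, huc, hxu, hu0⟩ := h.exists_delayed_continuousOn hT hper hφ k
  have hy := (h.isFlow_pieceExt hT k).congr_forcing (g := fun s => S.Gc s *ᵥ u s) fun s hs => by
    simp [forcing, hxu s hs]
  have hpost : 0 ≤ S.postJump hd T ψ wd x k := by
    rw [← pieceExt_zero (hc := hc) (wc := 0)]
    exact h.pieceExt_nonneg hT hx k 0 ⟨le_rfl, hk.le⟩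
  have hb := hpos.norm_le_final hk hK (fun t ht v => hAK t ⟨ht.1, ht.2.trans (hTc k)⟩ v) huc hpost
    (hu0 hx hφ0) hy τ (Set.Ioc_subset_Icc_self hτ)
  rw [← h.eq_pieceExt hτ, ← h.eq_pieceExt ⟨hk, le_rfl⟩, ← impulseTime_succ] at hb
  refine hb.trans ?_
  gcongr
  exact hTc k

/-- The `ε` term of the storage bound makes the impulse-time values of the dominating solution
summable, with sum at most a multiple of the initial norm. Bounding each term by the sum gives
stability, convergence of the terms to zero gives attractivity, and `norm_le_next` covers the times
in between. -/
theorem IsCertificate.asymptoticallyStable (hZ : S.IsCertificate Tbar ε γ Z Z') (hε : 0 < ε)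
    (hpos : S.InternallyPositive) (hc0 : 0 < hc) (hT : IsDwellSequence T)
    (hTbar : ∀ k, Tbar ≤ T k) (hN : 0 < N)
    (hper : ∀ k, impulseTime T (k + N) = impulseTime T k + hc) (hd : ℕ) :
    S.AsymptoticallyStable hc hd T := by
  have hTc := le_delay_of_period hT hN hper
  obtain ⟨C, hC, hbound⟩ := hZ.exists_storage_bound hpos hT hTbar hN hper hd
  obtain ⟨K, hK, hAK⟩ := exists_norm_mulVec_le isCompact_Icc (S.continuousOn_A_Icc hc)
  set D : ℝ := n * Real.exp (K * hc) with hD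
  have hD0 : 0 ≤ D := by positivity
  have key : ∀ (φ : ℝ → Fin n → ℝ) (ψ : ℕ → Fin n → ℝ) (x : ℝ → Fin n → ℝ),
      ContinuousOn φ (Set.Icc (-hc) 0) → S.IsSolution hc hd T φ ψ 0 0 x →
      ∃ r : ℕ → ℝ, (∀ k, 0 ≤ r k) ∧
        (∀ M, ε * ∑ k ∈ Finset.range M, r k ≤ C * initialNorm hc hd φ ψ) ∧
        ∀ k, ∀ τ ∈ Set.Ioc 0 (T k), l1norm (x (impulseTime T k + τ)) ≤ D * r k := by
    intro φ ψ x hφ h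
    have hz : IntegrableOn (0 : ℝ → Fin pc → ℝ) (Set.Ioi 0) := integrable_zero _ _ _
    obtain ⟨p, hp, hxp, -, -⟩ := hpos.exists_dominating hc0 hT hTc hφ hz h
    have e1 : (fun t => absVec ((0 : ℝ → Fin pc → ℝ) t)) = 0 := by ext; simp [absVec]
    have e2 : (fun k => absVec ((0 : ℕ → Fin pd → ℝ) k)) = 0 := by ext; simp [absVec]
    rw [e1, e2] at hp
    have hφ' : ContinuousOn (fun s => absVec (φ s)) (Set.Icc (-hc) 0) :=
      continuous_absVec.comp_continuousOn hφ
    obtain ⟨p1, p2, p3⟩ := hpos hc hd T hc0 hT _ _ 0 0 p hφ' hz.locallyIntegrableOn_Ici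
      (fun s _ => absVec_nonneg _) (fun j => absVec_nonneg _) (fun _ _ => le_rfl)
      (fun _ => le_rfl) hp
    have hp0 : ∀ k, 0 ≤ p (impulseTime T k) := fun k => p1 _ (hT.impulseTime_nonneg k)
    refine ⟨fun k => 1 ⬝ᵥ p (impulseTime T (k + 1)), fun k =>
      dotProduct_nonneg_of_pi_nonneg (fun _ => zero_le_one) (hp0 _), fun M => ?_, fun k τ hτ => ?_⟩
    · have hb := hbound _ _ 0 0 p hφ' hz.locallyIntegrableOn_Ici
        (fun s _ => absVec_nonneg _) (fun j => absVec_nonneg _) (fun _ _ => le_rfl)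
        (fun _ => le_rfl) hp M
      have h1 : 0 ≤ ∑ k ∈ Finset.range M,
          (∫ τ in (0 : ℝ)..T k, 1 ⬝ᵥ S.outputC hc 0 p (impulseTime T k + τ)) := by
        refine Finset.sum_nonneg fun k _ => ?_
        rw [intervalIntegral.integral_of_le (hT.1 k).le]
        refine setIntegral_nonneg measurableSet_Ioc fun τ hτ => ?_
        exact dotProduct_nonneg_of_pi_nonneg (fun _ => zero_le_one)
          (p2 _ (add_pos_of_nonneg_of_pos (hT.impulseTime_nonneg k) hτ.1))
      have h2 : 0 ≤ ∑ k ∈ Finset.range M,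
          1 ⬝ᵥ S.outputD hd T (fun j => absVec (ψ j)) 0 p (k + 1) :=
        Finset.sum_nonneg fun k _ => dotProduct_nonneg_of_pi_nonneg (fun _ => zero_le_one)
          (p3 _ (Nat.le_add_left 1 k))
      rw [initialNorm_absVec] at hb
      simp only [Pi.zero_apply, dotProduct_zero, intervalIntegral.integral_zero,
        Finset.sum_const_zero, add_zero, mul_zero] at hb
      linarith
    · have ht : 0 ≤ impulseTime T k + τ := add_nonneg (hT.impulseTime_nonneg k) hτ.1.le
      calc l1norm (x (impulseTime T k + τ)) ≤ 1 ⬝ᵥ p (impulseTime T k + τ) := hxp _ ht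
        _ = l1norm (p (impulseTime T k + τ)) := one_dotProduct_eq_l1norm (p1 _ ht)
        _ ≤ n * ‖p (impulseTime T k + τ)‖ := l1norm_le_card_mul_norm _
        _ ≤ n * (Real.exp (K * hc) * ‖p (impulseTime T (k + 1))‖) := by
            gcongr
            exact hp.norm_le_next hpos hT hper hTc hK hAK hφ' (fun s _ => absVec_nonneg _) p1 k hτ
        _ ≤ n * (Real.exp (K * hc) * (1 ⬝ᵥ p (impulseTime T (k + 1)))) := by
            gcongr
            rw [one_dotProduct_eq_l1norm (hp0 _)]
            exact norm_le_l1norm _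
        _ = _ := by rw [hD]; ring
  refine ⟨fun η hη => ?_, fun φ ψ x hφ h => ?_⟩
  -- The summand `1` serves `t = 0`, the rest all `t > 0`.
  · set W : ℝ := 1 + D * (C / ε) with hW
    have hW0 : 0 < W := by positivity
    refine ⟨η / W, by positivity, fun φ ψ x hφ h hI t ht => ?_⟩
    set I := initialNorm hc hd φ ψ with hIdef
    have hI0 : 0 ≤ I := initialNorm_nonneg _ _ _ _
    have hWI : W * I < η := by rwa [lt_div_iff₀ hW0, mul_comm] at hI
    refine lt_of_le_of_lt ?_ hWI
    rcases ht.eq_or_lt with h0 | h0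
    · have hmem : (0 : ℝ) ∈ Set.Icc (-hc) 0 := ⟨by linarith, le_rfl⟩
      rw [← h0, h.initial 0 hmem]
      refine (l1norm_le_initialNorm hd ψ hφ hmem).trans ?_
      have : 0 ≤ D * (C / ε) * I := by positivity
      rw [hW, add_mul, one_mul]; linarith
    · obtain ⟨r, hr0, hr, hxr⟩ := key φ ψ x hφ h
      obtain ⟨k, τ, hτ, rfl⟩ := hT.exists_mem_Ioc h0
      refine (hxr k τ hτ).trans ?_
      have h1 : r k ≤ ∑ j ∈ Finset.range (k + 1), r j :=
        Finset.single_le_sum (fun j _ => hr0 j) (Finset.self_mem_range_succ k)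
      have h2 : r k ≤ C / ε * I := by
        rw [div_mul_eq_mul_div, le_div_iff₀ hε, mul_comm]
        exact (mul_le_mul_of_nonneg_left h1 hε.le).trans (hr (k + 1))
      calc D * r k ≤ D * (C / ε * I) := mul_le_mul_of_nonneg_left h2 hD0
        _ ≤ W * I := by rw [hW, add_mul, one_mul]; linarith
  · obtain ⟨r, hr0, hr, hxr⟩ := key φ ψ x hφ h
    have hsum : Summable r := summable_of_sum_range_le (c := C * initialNorm hc hd φ ψ / ε) hr0
      fun M => by rw [le_div_iff₀ hε, mul_comm]; exact hr M
    have hlim : Tendsto (fun k => D * r k) atTop (𝓝 0) := by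
      simpa using hsum.tendsto_atTop_zero.const_mul D
    rw [Metric.tendsto_atTop]
    intro η hη
    obtain ⟨k0, hk0⟩ := (hlim.eventually (gt_mem_nhds hη)).exists_forall_of_atTop
    refine ⟨impulseTime T k0 + 1, fun t ht => ?_⟩
    obtain ⟨k, τ, hτ, rfl⟩ := hT.exists_mem_Ioc (t := t)
      (by linarith [hT.impulseTime_nonneg k0])
    have hk : k0 ≤ k := by
      by_contra hlt
      have := hT.strictMono.monotone (show k + 1 ≤ k0 by omega)
      rw [impulseTime_succ] at this
      linarith [hτ.2]
    rw [dist_zero_right]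
    exact ((norm_le_l1norm _).trans (hxr k τ hτ)).trans_lt (hk0 k hk)

/-- Applied to the dominating solution without its `ε` term, the storage bound controls the output
norms up to each `t_M`; then `M → ∞`. Absolute values leave the input norms unchanged, so `γ` is
preserved. -/
theorem IsCertificate.hybridGainLE (hZ : S.IsCertificate Tbar ε γ Z Z') (hε : 0 < ε) (hγ : 0 < γ)
    (hpos : S.InternallyPositive) (hc0 : 0 < hc) (hT : IsDwellSequence T)
    (hTbar : ∀ k, Tbar ≤ T k) (hN : 0 < N)
    (hper : ∀ k, impulseTime T (k + N) = impulseTime T k + hc) (hd : ℕ) :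
    S.HybridGainLE hc hd T γ := by
  have hTc := le_delay_of_period hT hN hper
  obtain ⟨C, hC, hbound⟩ := hZ.exists_storage_bound hpos hT hTbar hN hper hd
  -- `C + 1` instead of `C` keeps the function strictly increasing and unbounded when `C = 0`.
  refine ⟨fun s => (C + 1) * s, fun a _ b _ hab => ?_, by simp,
    tendsto_id.const_mul_atTop (by positivity), fun φ ψ wc wd x hφ hwc hwd h => ?_⟩
  · exact mul_lt_mul_of_pos_left hab (by positivity)
  obtain ⟨p, hp, hxp, hcp, hdp⟩ := hpos.exists_dominating hc0 hT hTc hφ hwc h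
  have hφ' : ContinuousOn (fun s => absVec (φ s)) (Set.Icc (-hc) 0) :=
    continuous_absVec.comp_continuousOn hφ
  have hwl := hwc.locallyIntegrableOn_Ici
  have hwl' := hwc.absVec_comp.locallyIntegrableOn_Ici
  set I := initialNorm hc hd φ ψ with hI
  have hI0 : 0 ≤ I := initialNorm_nonneg _ _ _ _
  set z : ℝ → Fin qc → ℝ := S.outputC hc wc x with hz
  have hzint := fun k => h.intervalIntegrable_outputC hT hper hφ hwl k
  have hzl1 : ∀ k, IntervalIntegrable (fun τ => l1norm (z (impulseTime T k + τ))) volume 0 (T k) :=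
    fun k => (hzint k).l1norm_comp
  have hwi : IntegrableOn (fun t => l1norm (wc t)) (Set.Ioi 0) := hwc.l1norm_comp
  set R : ℝ := γ * ((∫ t in Set.Ioi 0, l1norm (wc t)) + ∑' k, l1norm (wd (k + 1))) + C * I with hR
  have hpartial : ∀ M : ℕ, (∫ t in (0 : ℝ)..impulseTime T M, l1norm (z t))
      + ∑ k ∈ Finset.range M, l1norm (S.outputD hd T ψ wd x (k + 1)) ≤ R := by
    intro M
    obtain ⟨p1, -, -⟩ := hpos hc hd T hc0 hT _ _ _ _ p hφ' hwl'
      (fun s _ => absVec_nonneg _) (fun j => absVec_nonneg _) (fun _ _ => absVec_nonneg _)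
      (fun _ => absVec_nonneg _) hp
    have hb := hbound _ _ _ _ p hφ' hwl'
      (fun s _ => absVec_nonneg _) (fun j => absVec_nonneg _) (fun _ _ => absVec_nonneg _)
      (fun _ => absVec_nonneg _) hp M
    rw [initialNorm_absVec] at hb
    simp only [one_dotProduct_absVec] at hb
    rw [sum_integral_shift (f := fun t => l1norm (wc t)) M
      fun k => (intervalIntegrable_input_shift hT hwl k).l1norm_comp] at hb
    have h1 : 0 ≤ ε * ∑ k ∈ Finset.range M, 1 ⬝ᵥ p (impulseTime T (k + 1)) :=
      mul_nonneg hε.le (Finset.sum_nonneg fun k _ => dotProduct_nonneg_of_pi_nonneg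
        (fun _ => zero_le_one) (p1 _ (hT.impulseTime_nonneg _)))
    have h2 : ∫ t in (0 : ℝ)..impulseTime T M, l1norm (z t) ≤ ∑ k ∈ Finset.range M,
        (∫ τ in (0 : ℝ)..T k,
          1 ⬝ᵥ S.outputC hc (fun t => absVec (wc t)) p (impulseTime T k + τ)) := by
      rw [← sum_integral_shift (f := fun t => l1norm (z t)) M hzl1]
      refine Finset.sum_le_sum fun k _ => ?_
      refine intervalIntegral.integral_mono_on_of_le_Ioo (hT.1 k).le (hzl1 k)
        (IntervalIntegrable.dotProduct_fun (y := fun _ => 1) (hT.1 k).le continuousOn_const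
          (hp.intervalIntegrable_outputC hT hper hφ' hwl' k)) fun τ hτ => ?_
      exact hcp _ (add_pos_of_nonneg_of_pos (hT.impulseTime_nonneg k) hτ.1)
    have h3 : ∑ k ∈ Finset.range M, l1norm (S.outputD hd T ψ wd x (k + 1))
        ≤ ∑ k ∈ Finset.range M, 1 ⬝ᵥ S.outputD hd T (fun j => absVec (ψ j))
          (fun k => absVec (wd k)) p (k + 1) :=
      Finset.sum_le_sum fun k _ => hdp _ (Nat.le_add_left 1 k)
    have h4 : ∫ t in (0 : ℝ)..impulseTime T M, l1norm (wc t) ≤ ∫ t in Set.Ioi 0, l1norm (wc t) := by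
      rw [intervalIntegral.integral_of_le (hT.impulseTime_nonneg M)]
      exact setIntegral_mono_set hwi (Eventually.of_forall fun t => l1norm_nonneg _)
        (Set.Ioc_subset_Ioi_self.eventuallyLE)
    have h5 : ∑ k ∈ Finset.range M, l1norm (wd (k + 1)) ≤ ∑' k, l1norm (wd (k + 1)) :=
      hwd.sum_le_tsum _ fun k _ => l1norm_nonneg _
    have h6 := mul_le_mul_of_nonneg_left (add_le_add h4 h5) hγ.le
    linarith
  have hzloc : ∀ M, IntegrableOn z (Set.Ioc 0 (impulseTime T M)) := fun M => by
    rw [← intervalIntegrable_iff_integrableOn_Ioc_of_le (hT.impulseTime_nonneg M)]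
    have := IntervalIntegrable.trans_iterate (μ := volume) (f := z) (a := impulseTime T) (n := M)
      fun k _ => intervalIntegrable_of_shift k (hzint k)
    rwa [impulseTime_zero] at this
  have hInonneg : ∀ M, 0 ≤ ∫ t in (0 : ℝ)..impulseTime T M, l1norm (z t) := fun M =>
    intervalIntegral.integral_nonneg (hT.impulseTime_nonneg M) fun t _ => l1norm_nonneg _
  have hzI : IntegrableOn z (Set.Ioi 0) := by
    refine integrableOn_Ioi_of_intervalIntegral_norm_bounded R 0 hzloc hT.2
      (Eventually.of_forall fun M => ?_)
    have hzM := (intervalIntegrable_iff_integrableOn_Ioc_of_le (hT.impulseTime_nonneg M)).2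
      (hzloc M)
    have h1 : ∫ t in (0 : ℝ)..impulseTime T M, ‖z t‖
        ≤ ∫ t in (0 : ℝ)..impulseTime T M, l1norm (z t) :=
      intervalIntegral.integral_mono_on (hT.impulseTime_nonneg M) hzM.norm hzM.l1norm_comp
        fun t _ => norm_le_l1norm _
    have h2 : 0 ≤ ∑ k ∈ Finset.range M, l1norm (S.outputD hd T ψ wd x (k + 1)) :=
      Finset.sum_nonneg fun k _ => l1norm_nonneg _
    linarith [hpartial M]
  have hds : Summable fun k => l1norm (S.outputD hd T ψ wd x (k + 1)) :=
    summable_of_sum_range_le (c := R) (fun k => l1norm_nonneg _) fun M => by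
      linarith [hpartial M, hInonneg M]
  refine ⟨hzI, hds, ?_⟩
  have hlim := (intervalIntegral_tendsto_integral_Ioi 0 hzI.l1norm_comp hT.2).add
    hds.hasSum.tendsto_sum_nat
  refine (le_of_tendsto' hlim hpartial).trans ?_
  rw [hR]
  linarith

/-- The conditions at the dwell time and along the flow provide a certificate on `[0, ∞)`, by
extending the weight by a constant. -/
theorem isCertificate_of_inequalities (hTbar : 0 < Tbar) (hpos : S.InternallyPositive)
    (hconst : ∀ τ, Tbar ≤ τ → S.A τ = S.A Tbar ∧ S.Gc τ = S.Gc Tbar ∧ S.Ec τ = S.Ec Tbar)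
    {ζ ζ' : ℝ → Fin n → ℝ} (hε : 0 < ε)
    (hζ : ∀ τ ∈ Set.Icc 0 Tbar, HasDerivWithinAt ζ (ζ' τ) (Set.Icc 0 Tbar) τ)
    (hζ0 : ∀ i, 0 < ζ 0 i)
    (hTbar_x : ζ Tbar ᵥ* (S.A Tbar + S.Gc Tbar) + 1 ᵥ* (S.Cc + S.Hc) ≤ fun _ => -ε)
    (hflow_x : ∀ τ ∈ Set.Icc 0 Tbar,
      ζ' τ + (ζ τ ᵥ* (S.A τ + S.Gc τ) + 1 ᵥ* (S.Cc + S.Hc)) ≤ 0)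
    (hflow_w : ∀ τ ∈ Set.Icc 0 Tbar, ζ τ ᵥ* S.Ec τ + 1 ᵥ* S.Fc ≤ fun _ => γ)
    (hjump_x : -ζ Tbar + (ζ 0 ᵥ* (S.J + S.Gd) + 1 ᵥ* (S.Cd + S.Hd)) ≤ fun _ => -ε)
    (hjump_w : ζ 0 ᵥ* S.Ed + 1 ᵥ* S.Fd ≤ fun _ => γ) :
    S.IsCertificate Tbar ε γ (fun τ => ζ (min τ Tbar))
      (fun τ => if τ < Tbar then ζ' τ else 0) := by
  have hTm : Tbar ∈ Set.Icc 0 Tbar := ⟨hTbar.le, le_rfl⟩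
  have hjump : ∀ v, 0 ≤ v → ζ 0 ⬝ᵥ ((S.J + S.Gd) *ᵥ v) + 1 ⬝ᵥ ((S.Cd + S.Hd) *ᵥ v)
      + ε * (1 ⬝ᵥ v) ≤ ζ Tbar ⬝ᵥ v := fun v hv => by
    have h1 := dotProduct_mono_left hjump_x hv
    have h2 : (fun _ : Fin n => -ε) ⬝ᵥ v = -(ε * (1 ⬝ᵥ v)) := by simp [dotProduct, Finset.mul_sum]
    rw [h2, add_dotProduct, add_dotProduct, neg_dotProduct, ← dotProduct_mulVec,
      ← dotProduct_mulVec] at h1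
    linarith
  have hζ00 : 0 ≤ ζ 0 := fun i => (hζ0 i).le
  -- The sign of `ζ Tbar` comes from the jump inequality: `ζ 0` is positive, and the jump and output
  -- matrices preserve nonnegativity.
  have hζT : ∀ v, 0 ≤ v → 0 ≤ ζ Tbar ⬝ᵥ v := fun v hv => by
    have h1 := hjump v hv
    have h2 : 0 ≤ ζ 0 ⬝ᵥ ((S.J + S.Gd) *ᵥ v) := by
      rw [add_mulVec]
      exact dotProduct_nonneg_of_pi_nonneg hζ00 (add_nonneg (hpos.J_nonneg hv) (hpos.Gd_nonneg hv))
    have h3 : 0 ≤ 1 ⬝ᵥ ((S.Cd + S.Hd) *ᵥ v) := by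
      rw [add_mulVec]
      exact dotProduct_nonneg_of_pi_nonneg (fun _ => zero_le_one)
        (add_nonneg (hpos.Cd_nonneg hv) (hpos.Hd_nonneg hv))
    have h4 : 0 ≤ ε * (1 ⬝ᵥ v) :=
      mul_nonneg hε.le (dotProduct_nonneg_of_pi_nonneg (fun _ => zero_le_one) hv)
    linarith
  have hmin0 : min 0 Tbar = 0 := min_eq_left hTbar.le
  refine ⟨fun L hL => ⟨?_, fun s hs => ?_, fun s hs => ?_, fun s hs => ?_, fun v hv => ?_⟩,
    fun τ hτ => ?_, ?_, fun v hv => ?_, ?_⟩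
  · have hc : ContinuousOn ζ (Set.Icc 0 Tbar) := fun t ht => (hζ t ht).continuousWithinAt
    exact hc.comp (Continuous.continuousOn (by fun_prop)) fun s hs =>
      ⟨le_min hs.1 hTbar.le, min_le_right _ _⟩
  · by_cases h : s < Tbar
    · rw [if_pos h]
      have h1 := (hζ s ⟨hs.1.le, h.le⟩).hasDerivAt (Icc_mem_nhds hs.1 h)
      refine (h1.congr_of_eventuallyEq ?_).hasDerivWithinAt
      filter_upwards [gt_mem_nhds h] with r hr
      rw [min_eq_left hr.le]
    · rw [if_neg h]
      -- The extended weight may have a kink at `Tbar`; only the right derivative, which is `0`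
      -- there, is required.
      refine (hasDerivWithinAt_const s (Set.Ioi s) (ζ Tbar)).congr (fun r hr => ?_) ?_
      · rw [min_eq_right ((not_lt.1 h).trans (le_of_lt hr))]
      · rw [min_eq_right (not_lt.1 h)]
  · by_cases h : s < Tbar
    · simp only [if_pos h, min_eq_left h.le]
      exact hflow_x s ⟨hs.1.le, h.le⟩
    · simp only [if_neg h, min_eq_right (not_lt.1 h), zero_add]
      obtain ⟨e1, e2, -⟩ := hconst s (not_lt.1 h)
      rw [e1, e2]
      exact hTbar_x.trans fun _ => neg_nonpos.2 hε.le
  · by_cases h : s < Tbar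
    · simp only [min_eq_left h.le]
      exact hflow_w s ⟨hs.1, h.le⟩
    · simp only [min_eq_right (not_lt.1 h)]
      rw [(hconst s (not_lt.1 h)).2.2]
      exact hflow_w Tbar hTm
  · simp only [min_eq_right hL]; exact hζT v hv
  · simp only [min_eq_right hτ, min_self]
  · simp only [hmin0]; exact hζ00
  · simp only [hmin0, min_self]; exact hjump v hv
  · simp only [hmin0]; exact hjump_w

end ImpulsiveDelaySystem

theorem mainTheorem12 {n pc pd qc qd : ℕ} (S : ImpulsiveDelaySystem n pc pd qc qd)
    (Tbar : ℝ) (hTbar : 0 < Tbar)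
    (hpos : S.InternallyPositive)
    (hconst : ∀ τ, Tbar ≤ τ → S.A τ = S.A Tbar ∧ S.Gc τ = S.Gc Tbar ∧ S.Ec τ = S.Ec Tbar)
    (ζ ζ' : ℝ → Fin n → ℝ) (ε γ : ℝ) (hε : 0 < ε) (hγ : 0 < γ)
    (hζ : ∀ τ ∈ Set.Icc 0 Tbar, HasDerivWithinAt ζ (ζ' τ) (Set.Icc 0 Tbar) τ)
    (hζ0 : ∀ i, 0 < ζ 0 i)
    (hTbar_x : ζ Tbar ᵥ* (S.A Tbar + S.Gc Tbar) + 1 ᵥ* (S.Cc + S.Hc) ≤ fun _ => -ε)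
    (hTbar_w : ζ Tbar ᵥ* S.Ec Tbar + 1 ᵥ* S.Fc ≤ fun _ => γ)
    (hflow_x : ∀ τ ∈ Set.Icc 0 Tbar,
      ζ' τ + (ζ τ ᵥ* (S.A τ + S.Gc τ) + 1 ᵥ* (S.Cc + S.Hc)) ≤ 0)
    (hflow_w : ∀ τ ∈ Set.Icc 0 Tbar, ζ τ ᵥ* S.Ec τ + 1 ᵥ* S.Fc ≤ fun _ => γ)
    (hjump_x : -ζ Tbar + (ζ 0 ᵥ* (S.J + S.Gd) + 1 ᵥ* (S.Cd + S.Hd)) ≤ fun _ => -ε)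
    (hjump_w : ζ 0 ᵥ* S.Ed + 1 ᵥ* S.Fd ≤ fun _ => γ) :
    ∀ (hc : ℝ) (hd : ℕ), 0 < hc → ∀ T ∈ periodicMinDwell Tbar hc,
      S.AsymptoticallyStable hc hd T ∧ S.HybridGainLE hc hd T γ := by
  intro hc hd hc0 T hT
  obtain ⟨N, hN, hTk, hper⟩ := periodicMinDwell.exists_period hT
  have hdw := isDwellSequence_of_le hTbar hTk
  have hZ := ImpulsiveDelaySystem.isCertificate_of_inequalities hTbar hpos hconst hε hζ hζ0
    hTbar_x hflow_x hflow_w hjump_x hjump_w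
  exact ⟨hZ.asymptoticallyStable hε hpos hc0 hdw hTk hN hper hd,
    hZ.hybridGainLE hε hγ hpos hc0 hdw hTk hN hper hd⟩
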